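/- Let $G$ be a compact Lie group, let $H \le G$ be a closed subgroup, and suppose that the homogeneous space $N = G/H$ has positive dimension. Let $g_1$ and $g_2$ be two $G$-invariant Riemannian metrics on $N$. For a $G$-invariant metric $g$ write $\mathrm{vol}_g$ for its Riemannian measure and $\Delta_g$ for its Laplacian, with the sign for which the spectrum is non-positive: in local coordinates $\Delta_g f = \frac{1}{\sqrt{\det g}} \sum_{i,j} \partial_i\bigl(\sqrt{\det g}\, g^{ij}\, \partial_j f\bigr)$ for smooth $f$, and on $L^2(N)$ the operator $\Delta_g$ is the closure of the Laplacian on smooth functions. Here $L^2(N)$ is the space of real-valued or of complex-valued square-integrable functions; as a vector space it does not depend on the choice of the invariant metric. Let $V \neq 0$ be a finite-dimensional subspace of $L^2(N)$ that is invariant under both $\Delta_{g_1}$ and $\Delta_{g_2}$ (that is, $V$ is contained in the domain of each of them and is mapped to itself by each of them). Let $r_{\min}$ and $r_{\max}$ denote the minimum and the maximum eigenvalue of the dual metric $g_1^{-1}$ with respect to $g_2^{-1}$, that is, the smallest and the largest real $r$ such that at some point $x \in N$ there is a covector $0 \neq \alpha \in T_x^*N$ with $g_1^{-1}(\alpha,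 \cdot) = r\, g_2^{-1}(\alpha, \cdot)$. Let $\mu_{\min}$ and $\mu_{\max}$ denote the minimum and the maximum eigenvalue of $-\Delta_{g_2}$ on $V$. These four numbers exist, and every eigenvalue $\lambda$ of $-\Delta_{g_1}$ on $V$ is real and satisfies $$ r_{\min}\, \mu_{\min} \;\le\; \lambda \;\le\; r_{\max}\, \mu_{\max}. $$ -/

import Mathlib

open scoped Manifold ContDiff Topology ENNReal

noncomputable section

namespace HomogeneousLaplace

/-- Smooth Riemannian metrics on a smooth `n`-dimensional manifold `N` (without boundary). -/
abbrev Metric (n : ℕ) (N : Type*) [TopologicalSpace N] [ChartedSpace (EuclideanSpace ℝ (Fin n)) N]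
    [IsManifold (𝓡 n) ∞ N] :=
  Bundle.ContMDiffRiemannianMetric (𝓡 n) ∞ (EuclideanSpace ℝ (Fin n))
    (fun x : N => TangentSpace (𝓡 n) x)

section General

variable {n : ℕ} {N : Type*} [TopologicalSpace N] [ChartedSpace (EuclideanSpace ℝ (Fin n)) N]
  [IsManifold (𝓡 n) ∞ N]

/-- A metric on `N` is `G`-invariant if every `k : G` acts by isometries:
`g_{k • x} (dk v, dk w) = g_x (v, w)`. -/
def IsInvariantMetric (G : Type*) [SMul G N] (g : Metric n N) : Prop :=
  ∀ (k : G) (x : N) (v w : TangentSpace (𝓡 n) x),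
    g.inner (k • x) (mfderiv (𝓡 n) (𝓡 n) (fun y : N => k • y) x v)
        (mfderiv (𝓡 n) (𝓡 n) (fun y : N => k • y) x w) = g.inner x v w

instance tangentSpace_finiteDimensional (x : N) :
    FiniteDimensional ℝ (TangentSpace (𝓡 n) x) :=
  inferInstanceAs (FiniteDimensional ℝ (EuclideanSpace ℝ (Fin n)))

/-- Lowering an index: `v ↦ g_x (v, ·)`, from `T_x N` to `T_x^* N`. -/
def flat (g : Metric n N) (x : N) :
    TangentSpace (𝓡 n) x →ₗ[ℝ] Module.Dual ℝ (TangentSpace (𝓡 n) x) where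
  toFun v := (g.inner x v).toLinearMap
  map_add' v w := by ext; simp
  map_smul' c v := by ext; simp

theorem flat_injective (g : Metric n N) (x : N) : Function.Injective (flat g x) := by
  rw [injective_iff_map_eq_zero]
  intro v hv
  by_contra h
  have h1 := g.pos x v h
  have h2 : g.inner x v v = 0 := LinearMap.congr_fun hv v
  exact h1.ne' h2

/-- Raising an index: the inverse of `flat`. -/
def sharp (g : Metric n N) (x : N) :
    Module.Dual ℝ (TangentSpace (𝓡 n) x) ≃ₗ[ℝ] TangentSpace (𝓡 n) x :=
  (LinearMap.linearEquivOfInjective (flat g x) (flat_injective g x)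
    Subspace.dual_finrank_eq.symm).symm

/-- The dual metric `g⁻¹` on the cotangent space `T_x^* N`. -/
def dualMetric (g : Metric n N) (x : N) (α β : Module.Dual ℝ (TangentSpace (𝓡 n) x)) : ℝ :=
  g.inner x (sharp g x α) (sharp g x β)

/-- The eigenvalues of the dual metric `g₁⁻¹` with respect to `g₂⁻¹`: the reals `r` for which, at
some point `x`, there is `α ≠ 0` in `T_x^* N` with `g₁⁻¹ (α, ·) = r g₂⁻¹ (α, ·)`. -/
def dualEigenvalues (g₁ g₂ : Metric n N) : Set ℝ :=
  {r | ∃ (x : N) (α : Module.Dual ℝ (TangentSpace (𝓡 n) x)), α ≠ 0 ∧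
    ∀ β, dualMetric g₁ x α β = r * dualMetric g₂ x α β}

/-- The coordinate vector field `∂_i` of the preferred chart at `p`, at the point with
coordinates `y`. -/
def coordVec (p : N) (y : EuclideanSpace ℝ (Fin n)) (i : Fin n) :
    TangentSpace (𝓡 n) ((extChartAt (𝓡 n) p).symm y) :=
  mfderiv 𝓘(ℝ, EuclideanSpace ℝ (Fin n)) (𝓡 n) (extChartAt (𝓡 n) p).symm y
    (EuclideanSpace.single i (1 : ℝ))

/-- The matrix `(g_ij)` of the metric in the preferred chart at `p`. -/
def gram (g : Metric n N) (p : N) (y : EuclideanSpace ℝ (Fin n)) : Matrix (Fin n) (Fin n) ℝ :=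
  Matrix.of fun i j => g.inner ((extChartAt (𝓡 n) p).symm y) (coordVec p y i) (coordVec p y j)

/-- The Riemannian density `√det (g_ij)` in the preferred chart at `p`. -/
def density (g : Metric n N) (p : N) (y : EuclideanSpace ℝ (Fin n)) : ℝ :=
  √(gram g p y).det

/-- The Riemannian measure `vol_g` restricted to the domain of the preferred chart at `p`: the
image under the inverse chart of the measure `√det (g_ij) dy`. -/
def chartVol [MeasurableSpace N] (g : Metric n N) (p : N) : MeasureTheory.Measure N :=
  (((MeasureTheory.volume : MeasureTheory.Measure (EuclideanSpace ℝ (Fin n))).restrict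
    (extChartAt (𝓡 n) p).target).withDensity
      fun y => ENNReal.ofReal (density g p y)).map (extChartAt (𝓡 n) p).symm

/-- The Riemannian measure `vol_g` of a compact (more generally, a Lindelöf) manifold. The local
measures `chartVol g p` agree on the overlaps of the charts, and `vol_g`, the measure that
restricts to each of them, is their least upper bound. -/
def vol [MeasurableSpace N] (g : Metric n N) : MeasureTheory.Measure N :=
  ⨆ p : N, chartVol g p

/-- The partial derivative `∂_i u`. -/
def partialDeriv {𝕜 : Type*} [RCLike 𝕜] (i : Fin n) (u : EuclideanSpace ℝ (Fin n) → 𝕜)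
    (y : EuclideanSpace ℝ (Fin n)) : 𝕜 :=
  fderiv ℝ u y (EuclideanSpace.single i (1 : ℝ))

/-- The Laplacian (with non-positive spectrum) of a smooth function,
`Δ_g f = (1 / √det g) ∑_i ∂_i (√det g ∑_j g^ij ∂_j f)`,
computed at each point `p` in the preferred chart at `p`. -/
def laplacian {𝕜 : Type*} [RCLike 𝕜] (g : Metric n N) (f : N → 𝕜) (p : N) : 𝕜 :=
  (density g p (extChartAt (𝓡 n) p p))⁻¹ •
    ∑ i, partialDeriv i
      (fun y => density g p y •
        ∑ j, ((gram g p y)⁻¹ i j) • partialDeriv j (f ∘ (extChartAt (𝓡 n) p).symm) y)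
      (extChartAt (𝓡 n) p p)

/-- `h = Δ_g f` for the Laplacian as a closed operator on `L²(N)`, that is, the closure of the
Laplacian on smooth functions: there are smooth `u_k` with `u_k → f` and `Δ_g u_k → h` in `L²`. -/
def IsL2Laplacian {𝕜 : Type*} [RCLike 𝕜] [MeasurableSpace N] (g : Metric n N) (f h : N → 𝕜) :
    Prop :=
  MeasureTheory.MemLp f 2 (vol g) ∧ MeasureTheory.MemLp h 2 (vol g) ∧
  ∃ u : ℕ → N → 𝕜, (∀ k, ContMDiff (𝓡 n) 𝓘(ℝ, 𝕜) ∞ (u k)) ∧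
    Filter.Tendsto (fun k => MeasureTheory.eLpNorm (u k - f) 2 (vol g)) Filter.atTop (𝓝 0) ∧
    Filter.Tendsto (fun k => MeasureTheory.eLpNorm (laplacian g (u k) - h) 2 (vol g))
      Filter.atTop (𝓝 0)

/-- A subspace `V` of `L²(N)` lies in the domain of `Δ_g` and is mapped to itself by it. Here the
norm of `L²(N)` is taken with respect to a metric `g₀`. -/
def LaplacianInvariant {𝕜 : Type*} [RCLike 𝕜] [MeasurableSpace N] {g₀ : Metric n N}
    (g : Metric n N) (V : Submodule 𝕜 (MeasureTheory.Lp 𝕜 2 (vol g₀))) : Prop :=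
  ∀ f ∈ V, ∃ h ∈ V, IsL2Laplacian g (f : N → 𝕜) (h : N → 𝕜)

/-- The eigenvalues of `-Δ_g` on a subspace `V` of `L²(N)`. -/
def laplaceEigenvalues {𝕜 : Type*} [RCLike 𝕜] [MeasurableSpace N] {g₀ : Metric n N}
    (g : Metric n N) (V : Submodule 𝕜 (MeasureTheory.Lp 𝕜 2 (vol g₀))) : Set 𝕜 :=
  {l | ∃ f ∈ V, f ≠ 0 ∧ IsL2Laplacian g (f : N → 𝕜) ((-l) • (f : N → 𝕜))}

end General

end HomogeneousLaplace

end

/-! The proof is a comparison of Rayleigh quotients. Since `G` acts transitively by maps that are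
isometries for both metrics, the pair `(g₁, g₂)` looks the same at every point. Two consequences
follow. The ratio of the two Riemannian densities is a constant, so the two volumes are proportional
(`exists_vol_eq_smul`) and both Laplacians are symmetric on one and the same `L²` space. Also, the
eigenvalues of `g₁⁻¹` relative to `g₂⁻¹` do not depend on the point (`dualEigenvalues_eq_at`), so
they are finite in number, positive, and the extreme ones give `rmin g₂⁻¹ ≤ g₁⁻¹ ≤ rmax g₂⁻¹` on all
of `N`.

By Green's formula (`integral_laplacian_mul`) the energy of a smooth `u` for either metric is the
integral of `gᵢ⁻¹(du, du)` against the common measure. Integrating the pointwise inequality gives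
`rmin E₂(u) ≤ E₁(u) ≤ rmax E₂(u)`. This passes to the closed operators by `energy_bounds`. If `f ∈
V` is an eigenvector of `-Δ₁` for `λ`, then `λ‖f‖² = E₁(f)`, and `E₂(f)` lies between `μmin ‖f‖²`
and `μmax ‖f‖²` by the finite-dimensional spectral theorem on `V`; this uses `rmin > 0`.

Green's formula takes most of the work: `laplacian` uses a different chart at each point and `vol`
is a supremum of chart measures, so both must first be shown to be computable in any one chart. -/

noncomputable section

namespace HomogeneousLaplace

/-! ### Closures of symmetric operators and their quadratic forms -/

section ClosedOperators

open Filter RCLike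

variable {𝕜 H D : Type*} [RCLike 𝕜] [NormedAddCommGroup H] [InnerProductSpace 𝕜 H]
  [AddCommGroup D] [Module 𝕜 D]

/-- The closure of the graph of an operator `L` with domain `ι : D → H`. -/
def ClosureGraph (ι L : D →ₗ[𝕜] H) (f h : H) : Prop :=
  ∃ u : ℕ → D, Tendsto (fun k => ι (u k)) atTop (𝓝 f) ∧ Tendsto (fun k => L (u k)) atTop (𝓝 h)

/-- An operator with `⟪L u, v⟫ = ⟪u, L v⟫` on its domain. -/
def SymmOn (ι L : D →ₗ[𝕜] H) : Prop :=
  ∀ u v, inner 𝕜 (L u) (ι v) = inner 𝕜 (ι u) (L v)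

/-- The energy `-re ⟪L u, u⟫`. -/
def energy (ι L : D →ₗ[𝕜] H) (u : D) : ℝ := -re (inner 𝕜 (L u) (ι u))

variable {ι L L₁ L₂ : D →ₗ[𝕜] H}

/-- Symmetry survives the closure because the inner product is continuous. Uniqueness of the closed
operator and reality of its eigenvalues both come from this. -/
theorem ClosureGraph.symm (hL : SymmOn ι L) {f h f' h' : H}
    (h₁ : ClosureGraph ι L f h) (h₂ : ClosureGraph ι L f' h') :
    inner 𝕜 h f' = inner 𝕜 f h' := by
  obtain ⟨u, hu, hLu⟩ := h₁
  obtain ⟨v, hv, hLv⟩ := h₂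
  refine tendsto_nhds_unique (hLu.inner hv) ?_
  simp_rw [hL (u _) (v _)]
  exact hu.inner hLv

theorem ClosureGraph.add {f h f' h' : H} (h₁ : ClosureGraph ι L f h)
    (h₂ : ClosureGraph ι L f' h') : ClosureGraph ι L (f + f') (h + h') := by
  obtain ⟨u, hu, hLu⟩ := h₁
  obtain ⟨v, hv, hLv⟩ := h₂
  exact ⟨u + v, by simpa using hu.add hv, by simpa using hLu.add hLv⟩

theorem ClosureGraph.smul {f h : H} (c : 𝕜) (h₁ : ClosureGraph ι L f h) :
    ClosureGraph ι L (c • f) (c • h) := by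
  obtain ⟨u, hu, hLu⟩ := h₁
  exact ⟨c • u, by simpa using hu.const_smul c, by simpa using hLu.const_smul c⟩

theorem SymmOn.energy_sub (hL : SymmOn ι L) (u v : D) :
    energy ι L (u - v) = energy ι L u + 2 * re (inner 𝕜 (L u) (ι v)) + energy ι L v := by
  have h : re (inner 𝕜 (L v) (ι u)) = re (inner 𝕜 (L u) (ι v)) := by
    rw [hL v u, ← inner_conj_symm, conj_re]
  simp only [energy, map_sub, inner_sub_left, inner_sub_right, h]
  ring

/-- The parallelogram law with the nonnegative term for `u + v` dropped. -/
theorem SymmOn.energy_sub_le (hL : SymmOn ι L) (h0 : ∀ u, 0 ≤ energy ι L u) (u v : D) :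
    energy ι L (u - v) ≤ 2 * energy ι L u + 2 * energy ι L v := by
  have h1 := h0 (u + v)
  have h2 := hL.energy_sub u v
  have h3 := hL.energy_sub u (-v)
  simp only [sub_neg_eq_add, map_neg, inner_neg_right] at h3
  have h4 : energy ι L (-v) = energy ι L v := by simp [energy]
  linarith

theorem tendsto_energy {u : ℕ → D} {f h : H}
    (hu : Tendsto (fun k => ι (u k)) atTop (𝓝 f)) (hLu : Tendsto (fun k => L (u k)) atTop (𝓝 h)) :
    Tendsto (fun k => energy ι L (u k)) atTop (𝓝 (-re (inner 𝕜 h f))) :=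
  ((continuous_re.tendsto _).comp (hLu.inner hu)).neg

/-- Graph convergence makes the sequence Cauchy for the energy form, since both factors of the inner
product tend to zero. -/
theorem tendsto_energy_sub {u : ℕ → D} {f h : H}
    (hu : Tendsto (fun k => ι (u k)) atTop (𝓝 f)) (hLu : Tendsto (fun k => L (u k)) atTop (𝓝 h)) :
    Tendsto (fun p : ℕ × ℕ => energy ι L (u p.1 - u p.2)) atTop (𝓝 0) := by
  rw [← prod_atTop_atTop_eq]
  have a := (hu.comp (tendsto_fst (f := atTop) (g := atTop (α := ℕ)))).sub
    (hu.comp (tendsto_snd (f := atTop (α := ℕ)) (g := atTop)))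
  have b := (hLu.comp (tendsto_fst (f := atTop) (g := atTop (α := ℕ)))).sub
    (hLu.comp (tendsto_snd (f := atTop (α := ℕ)) (g := atTop)))
  have := ((continuous_re.tendsto _).comp (b.inner (𝕜 := 𝕜) a)).neg
  simpa [energy, Function.comp_def] using this

/-- The form of `L₁` is comparable with that of `L₂` on the closures as well. -/
theorem energy_bounds (hL₁ : SymmOn ι L₁) {a b : ℝ} (ha : 0 ≤ a)
    (h0 : ∀ u, 0 ≤ energy ι L₂ u) (hab : ∀ u, a * energy ι L₂ u ≤ energy ι L₁ u)
    (hb : ∀ u, energy ι L₁ u ≤ b * energy ι L₂ u) {f h₁ h₂ : H}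
    (hf₁ : ClosureGraph ι L₁ f h₁) (hf₂ : ClosureGraph ι L₂ f h₂) :
    a * -re (inner 𝕜 h₂ f) ≤ -re (inner 𝕜 h₁ f) ∧
      -re (inner 𝕜 h₁ f) ≤ b * -re (inner 𝕜 h₂ f) := by
  obtain ⟨u, hu, hLu⟩ := hf₁
  obtain ⟨w, hw, hLw⟩ := hf₂
  have h0' : ∀ u, 0 ≤ energy ι L₁ u := fun u => (mul_nonneg ha (h0 u)).trans (hab u)
  -- The two closures may use different approximating sequences. The aim is that `w`, chosen for
  -- `L₂`, also computes the `L₁`-energy of `f`; this holds once the `L₁`-energy of `u - w` tends to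
  -- zero.
  set v : ℕ → D := fun k => u k - w k with hv
  have hv0 : Tendsto (fun k => ι (v k)) atTop (𝓝 0) := by simpa [hv] using hu.sub hw
  -- `u` is Cauchy in the `L₁`-energy, and `w` is too because that energy is at most `b` times the
  -- `L₂`-energy.
  have hpair : Tendsto (fun p : ℕ × ℕ => energy ι L₁ (v p.1 - v p.2)) atTop (𝓝 0) := by
    have hlim := ((tendsto_energy_sub hu hLu).const_mul 2).add
      (((tendsto_energy_sub hw hLw).const_mul b).const_mul 2)
    simp only [mul_zero, add_zero] at hlim
    refine squeeze_zero (fun _ => h0' _) (fun p => ?_) hlim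
    have : v p.1 - v p.2 = (u p.1 - u p.2) - (w p.1 - w p.2) := by simp only [hv]; abel
    rw [this]
    have := hL₁.energy_sub_le h0' (u p.1 - u p.2) (w p.1 - w p.2)
    have := hb (w p.1 - w p.2)
    linarith
  have hvE : Tendsto (fun k => energy ι L₁ (v k)) atTop (𝓝 0) := by
    rw [Metric.tendsto_atTop] at hpair ⊢
    intro ε hε
    obtain ⟨⟨M, N⟩, hMN⟩ := hpair (ε / 2) (half_pos hε)
    refine ⟨max M N, fun m hm => ?_⟩
    -- Closability of the form: expand the energy of `v m - v k`, drop the energy of `v k`, and let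
    -- `k → ∞` with `m` fixed. The cross term vanishes in the limit because `ι (v k) → 0` while `L₁
    -- (v m)` stays fixed.
    have hle : energy ι L₁ (v m) ≤ ε / 2 := by
      have hlim : Tendsto (fun k => ε / 2 - 2 * re (inner 𝕜 (L₁ (v m)) (ι (v k)))) atTop
          (𝓝 (ε / 2)) := by
        have := ((continuous_re.tendsto _).comp
          ((tendsto_const_nhds (x := L₁ (v m))).inner (𝕜 := 𝕜) hv0)).const_mul 2
        simpa using (tendsto_const_nhds (x := ε / 2)).sub this
      refine ge_of_tendsto hlim ?_
      filter_upwards [eventually_ge_atTop (max M N)] with k hk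
      have h1 := hMN (m, k) ⟨(le_max_left _ _).trans hm, (le_max_right _ _).trans hk⟩
      rw [Real.dist_eq, sub_zero] at h1
      have h2 := (le_abs_self _).trans h1.le
      have h3 := hL₁.energy_sub (v m) (v k)
      have h4 := h0' (v k)
      simp only at h2
      linarith
    rw [Real.dist_eq, sub_zero, abs_of_nonneg (h0' _)]
    linarith
  have hE₂ := tendsto_energy hw hLw
  have hE₁ : Tendsto (fun k => energy ι L₁ (w k)) atTop (𝓝 (-re (inner 𝕜 h₁ f))) := by
    have hw' : ∀ k, energy ι L₁ (w k) =
        energy ι L₁ (u k) + 2 * re (inner 𝕜 (L₁ (u k)) (ι (v k))) + energy ι L₁ (v k) := by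
      intro k
      rw [← hL₁.energy_sub]
      simp [hv]
    simp_rw [hw']
    have := ((continuous_re.tendsto _).comp (hLu.inner (𝕜 := 𝕜) hv0)).const_mul 2
    simpa using ((tendsto_energy hu hLu).add this).add hvE
  exact ⟨le_of_tendsto_of_tendsto' (hE₂.const_mul a) hE₁ fun k => hab _,
    le_of_tendsto_of_tendsto' hE₁ (hE₂.const_mul b) fun k => hb _⟩

/-- The eigenvalues of `-L`, for the closure of `L`, on a subspace. -/
def negEigenvalues (ι L : D →ₗ[𝕜] H) (V : Submodule 𝕜 H) : Set 𝕜 :=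
  {l | ∃ f ∈ V, f ≠ 0 ∧ ClosureGraph ι L f (-l • f)}

/-- A symmetric operator on a nontrivial finite-dimensional space has a least and a greatest
eigenvalue, and they bound its quadratic form. -/
theorem exists_extremal_eigenvalues {E : Type*} [NormedAddCommGroup E] [InnerProductSpace 𝕜 E]
    [FiniteDimensional 𝕜 E] [Nontrivial E] {T : E →ₗ[𝕜] E} (hT : T.IsSymmetric) :
    ∃ a b : ℝ, IsLeast {μ : ℝ | ∃ x, x ≠ 0 ∧ T x = (μ : 𝕜) • x} a ∧
      IsGreatest {μ : ℝ | ∃ x, x ≠ 0 ∧ T x = (μ : 𝕜) • x} b ∧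
      ∀ x, a * ‖x‖ ^ 2 ≤ re (inner 𝕜 (T x) x) ∧ re (inner 𝕜 (T x) x) ≤ b * ‖x‖ ^ 2 := by
  have hpos : 0 < Module.finrank 𝕜 E := Module.finrank_pos
  set m := Module.finrank 𝕜 E with hm
  have : Nonempty (Fin m) := ⟨⟨0, hpos⟩⟩
  set ev := hT.eigenvalues hm.symm
  set e := hT.eigenvectorBasis hm.symm
  have hTe : ∀ i, T (e i) = (ev i : 𝕜) • e i := fun i => hT.apply_eigenvectorBasis hm.symm i
  have hne : ∀ i, e i ≠ 0 := fun i => e.orthonormal.ne_zero i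
  obtain ⟨i₀, hi₀⟩ := Finite.exists_min ev
  obtain ⟨i₁, hi₁⟩ := Finite.exists_max ev
  -- In an orthonormal eigenbasis the form is a weighted sum of eigenvalues whose weights add up to
  -- `‖x‖ ^ 2`.
  have hq : ∀ x, re (inner 𝕜 (T x) x) = ∑ i, ev i * ‖inner 𝕜 (e i) x‖ ^ 2 := by
    intro x
    rw [← e.sum_inner_mul_inner (T x) x, map_sum]
    refine Finset.sum_congr rfl fun i _ => ?_
    rw [hT x (e i), hTe, inner_smul_right, mul_assoc, re_ofReal_mul, ← inner_conj_symm x (e i),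
      RCLike.conj_mul]
    norm_cast
  have hn : ∀ x, ‖x‖ ^ 2 = ∑ i, ‖inner 𝕜 (e i) x‖ ^ 2 := fun x => (e.sum_sq_norm_inner_right x).symm
  have hb : ∀ x, ev i₀ * ‖x‖ ^ 2 ≤ re (inner 𝕜 (T x) x) ∧
      re (inner 𝕜 (T x) x) ≤ ev i₁ * ‖x‖ ^ 2 := by
    intro x
    rw [hq, hn, Finset.mul_sum, Finset.mul_sum]
    exact ⟨Finset.sum_le_sum fun i _ => mul_le_mul_of_nonneg_right (hi₀ i) (sq_nonneg _),
      Finset.sum_le_sum fun i _ => mul_le_mul_of_nonneg_right (hi₁ i) (sq_nonneg _)⟩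
  have hev : ∀ (μ : ℝ) (x : E), x ≠ 0 → T x = (μ : 𝕜) • x →
      re (inner 𝕜 (T x) x) = μ * ‖x‖ ^ 2 := by
    intro μ x _ h
    rw [h, inner_smul_left, conj_ofReal, re_ofReal_mul, inner_self_eq_norm_sq]
  refine ⟨ev i₀, ev i₁, ⟨⟨_, hne i₀, hTe i₀⟩, ?_⟩, ⟨⟨_, hne i₁, hTe i₁⟩, ?_⟩, hb⟩
  · rintro μ ⟨x, hx, h⟩
    have := (hb x).1
    rw [hev μ x hx h] at this
    exact le_of_mul_le_mul_right this (by positivity)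
  · rintro μ ⟨x, hx, h⟩
    have := (hb x).2
    rw [hev μ x hx h] at this
    exact le_of_mul_le_mul_right this (by positivity)

/-- On a subspace of the domain of the closure, the operator is unique. -/
theorem ClosureGraph.unique (hL : SymmOn ι L) {V : Submodule 𝕜 H}
    (hV : ∀ f ∈ V, ∃ h ∈ V, ClosureGraph ι L f h) {f h h' : H} (hh : h ∈ V) (hh' : h' ∈ V)
    (h₁ : ClosureGraph ι L f h) (h₂ : ClosureGraph ι L f h') : h = h' := by
  -- Pair both images with `h - h'`, which itself lies in the domain: by symmetry both pairings
  -- equal `⟪f, k⟫`, so `h - h'` has norm zero. No density of the domain is needed.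
  obtain ⟨k, -, hk⟩ := hV (h - h') (V.sub_mem hh hh')
  rw [← sub_eq_zero, ← inner_self_eq_zero (𝕜 := 𝕜), inner_sub_left, h₁.symm hL hk,
    h₂.symm hL hk, sub_self]

/-- On an invariant finite-dimensional `V` the closure is an honest linear map, because its values
in `V` are unique; it is symmetric, so the spectral theorem applies to its negative. -/
theorem exists_extremal_negEigenvalues (hL : SymmOn ι L) {V : Submodule 𝕜 H}
    [FiniteDimensional 𝕜 V] (hV0 : V ≠ ⊥) (hV : ∀ f ∈ V, ∃ h ∈ V, ClosureGraph ι L f h) :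
    ∃ a b : ℝ, IsLeast {μ : ℝ | (μ : 𝕜) ∈ negEigenvalues ι L V} a ∧
      IsGreatest {μ : ℝ | (μ : 𝕜) ∈ negEigenvalues ι L V} b ∧
      ∀ f ∈ V, ∀ h ∈ V, ClosureGraph ι L f h →
        a * ‖f‖ ^ 2 ≤ -re (inner 𝕜 h f) ∧ -re (inner 𝕜 h f) ≤ b * ‖f‖ ^ 2 := by
  choose! T hTV hT using hV
  have huniq {f h h' : H} (hh : h ∈ V) (hh' : h' ∈ V)
      (h₁ : ClosureGraph ι L f h) (h₂ : ClosureGraph ι L f h') : h = h' :=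
    ClosureGraph.unique hL (fun f hf => ⟨T f, hTV f hf, hT f hf⟩) hh hh' h₁ h₂
  let S : V →ₗ[𝕜] V :=
    { toFun := fun f => -⟨T f, hTV f f.2⟩
      map_add' := fun f g => by
        rw [← neg_add]
        congr 1
        exact Subtype.ext (huniq (hTV _ (f + g).2) (V.add_mem (hTV _ f.2) (hTV _ g.2))
          (hT _ (f + g).2) ((hT _ f.2).add (hT _ g.2)))
      map_smul' := fun c f => by
        rw [RingHom.id_apply, smul_neg]
        congr 1
        exact Subtype.ext (huniq (hTV _ (c • f).2) (V.smul_mem c (hTV _ f.2))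
          (hT _ (c • f).2) ((hT _ f.2).smul c)) }
  have hS : ∀ f : V, ((S f : V) : H) = -T f := fun f => rfl
  have hSs : S.IsSymmetric := by
    intro f g
    rw [Submodule.coe_inner, Submodule.coe_inner, hS, hS, inner_neg_left, inner_neg_right,
      (hT f f.2).symm hL (hT g g.2)]
  have : Nontrivial V := (Submodule.nontrivial_iff_ne_bot).mpr hV0
  obtain ⟨a, b, ha, hb, hab⟩ := exists_extremal_eigenvalues hSs
  have hset : {μ : ℝ | (μ : 𝕜) ∈ negEigenvalues ι L V} =
      {μ : ℝ | ∃ x, x ≠ 0 ∧ S x = (μ : 𝕜) • x} := by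
    ext μ
    constructor
    · rintro ⟨f, hf, hf0, h⟩
      refine ⟨⟨f, hf⟩, fun h0 => hf0 (congrArg Subtype.val h0), Subtype.ext ?_⟩
      rw [hS, huniq (hTV f hf) (V.smul_mem _ hf) (hT f hf) h, neg_smul, neg_neg]
      rfl
    · rintro ⟨f, hf0, h⟩
      refine ⟨f, f.2, fun h0 => hf0 (Subtype.ext h0), ?_⟩
      have h' : -T f = (μ : 𝕜) • (f : H) := by rw [← hS, h]; rfl
      rw [neg_smul, ← h', neg_neg]
      exact hT f f.2
  rw [hset]
  refine ⟨a, b, ha, hb, fun f hf h hh hfh => ?_⟩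
  have := hab ⟨f, hf⟩
  rwa [Submodule.coe_inner, hS, inner_neg_left, map_neg, huniq (hTV f hf) hh (hT f hf) hfh] at this

/-- Two-sided bounds for the eigenvalues of `-L₁` on a common invariant subspace. -/
theorem eigenvalue_bounds (hL₁ : SymmOn ι L₁) (hL₂ : SymmOn ι L₂) {a b : ℝ} (ha : 0 ≤ a)
    (hb0 : 0 ≤ b)
    (h0 : ∀ u, 0 ≤ energy ι L₂ u) (hab : ∀ u, a * energy ι L₂ u ≤ energy ι L₁ u)
    (hb : ∀ u, energy ι L₁ u ≤ b * energy ι L₂ u) {V : Submodule 𝕜 H}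
    [FiniteDimensional 𝕜 V] (hV0 : V ≠ ⊥) (hV₂ : ∀ f ∈ V, ∃ h ∈ V, ClosureGraph ι L₂ f h) :
    ∃ μmin μmax : ℝ, IsLeast {μ : ℝ | (μ : 𝕜) ∈ negEigenvalues ι L₂ V} μmin ∧
      IsGreatest {μ : ℝ | (μ : 𝕜) ∈ negEigenvalues ι L₂ V} μmax ∧
      ∀ l ∈ negEigenvalues ι L₁ V, ∃ t : ℝ, l = (t : 𝕜) ∧ a * μmin ≤ t ∧ t ≤ b * μmax := by
  obtain ⟨μ₀, μ₁, hμ₀, hμ₁, hμ⟩ := exists_extremal_negEigenvalues hL₂ hV0 hV₂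
  refine ⟨μ₀, μ₁, hμ₀, hμ₁, ?_⟩
  rintro l ⟨f, hf, hf0, hl⟩
  obtain ⟨h₂, hh₂, hfh₂⟩ := hV₂ f hf
  -- Symmetry of the closure applied to the eigenvector paired with itself.
  have hreal : (starRingEnd 𝕜) l = l := by
    have := hl.symm hL₁ hl
    rw [inner_smul_left, inner_smul_right] at this
    have := mul_right_cancel₀ (by simpa using hf0) this
    simpa using this
  refine ⟨re l, (conj_eq_iff_re.mp hreal).symm, ?_⟩
  have hE : -re (inner 𝕜 (-l • f) f) = re l * ‖f‖ ^ 2 := by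
    rw [neg_smul, inner_neg_left, map_neg, neg_neg, inner_smul_left, hreal,
      ← conj_eq_iff_re.mp hreal, re_ofReal_mul, inner_self_eq_norm_sq]
    simp
  obtain ⟨h1, h2⟩ := energy_bounds hL₁ ha h0 hab hb hl hfh₂
  obtain ⟨h3, h4⟩ := hμ f hf h₂ hh₂ hfh₂
  rw [hE] at h1 h2
  have hpos : 0 < ‖f‖ ^ 2 := by positivity
  constructor
  · refine le_of_mul_le_mul_right ?_ hpos
    rw [mul_assoc]
    exact (mul_le_mul_of_nonneg_left h3 ha).trans h1
  · refine le_of_mul_le_mul_right ?_ hpos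
    rw [mul_assoc]
    exact h2.trans (mul_le_mul_of_nonneg_left h4 hb0)

end ClosedOperators

/-! ### Smoothness of determinants and inverse matrices -/

section MatrixSmooth

variable {E : Type*} [NormedAddCommGroup E] [NormedSpace ℝ E] {s : Set E} {n : ℕ}
  {M : E → Matrix (Fin n) (Fin n) ℝ}

theorem contDiffOn_det (hM : ∀ i j, ContDiffOn ℝ ∞ (fun y => M y i j) s) :
    ContDiffOn ℝ ∞ (fun y => (M y).det) s := by
  simp only [Matrix.det_apply]
  refine ContDiffOn.sum fun σ _ => ContDiffOn.const_smul _ ?_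
  exact contDiffOn_prod fun i _ => hM _ _

theorem contDiffOn_inv_apply (hM : ∀ i j, ContDiffOn ℝ ∞ (fun y => M y i j) s)
    (hdet : ∀ y ∈ s, (M y).det ≠ 0) (i j : Fin n) :
    ContDiffOn ℝ ∞ (fun y => (M y)⁻¹ i j) s := by
  simp only [Matrix.inv_def, Matrix.smul_apply, Ring.inverse_eq_inv', Matrix.adjugate_apply,
    smul_eq_mul]
  refine ((contDiffOn_det hM).inv hdet).mul (contDiffOn_det fun k l => ?_)
  by_cases h : k = j
  · subst h
    simp only [Matrix.updateRow_self]
    exact contDiffOn_const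
  · simp only [Matrix.updateRow_ne h]
    exact hM k l

end MatrixSmooth

/-! ### Metrics, dual metrics and densities in a chart -/

section Chart

variable {n : ℕ} {N : Type*} [TopologicalSpace N] [ChartedSpace (EuclideanSpace ℝ (Fin n)) N]
  [IsManifold (𝓡 n) ∞ N]

section LinearAlgebra

variable (g : Metric n N) (x : N)

/-- The Gram matrix of a family of tangent vectors. -/
def gramOf (b : Fin n → TangentSpace (𝓡 n) x) : Matrix (Fin n) (Fin n) ℝ :=
  Matrix.of fun i j => g.inner x (b i) (b j)

theorem inner_sum_sum (b : Fin n → TangentSpace (𝓡 n) x) (c c' : Fin n → ℝ) :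
    g.inner x (∑ i, c i • b i) (∑ j, c' j • b j) = c ⬝ᵥ (gramOf g x b).mulVec c' := by
  simp only [map_sum, map_smul, sum_apply, smul_apply,
    smul_eq_mul, dotProduct, Matrix.mulVec, gramOf, Matrix.of_apply]
  simp only [Finset.mul_sum]
  rw [Finset.sum_comm]
  refine Finset.sum_congr rfl fun i _ => ?_
  exact Finset.sum_congr rfl fun j _ => by ring

theorem gramOf_posDef (b : Module.Basis (Fin n) ℝ (TangentSpace (𝓡 n) x)) :
    (gramOf g x b).PosDef := by
  refine Matrix.PosDef.of_dotProduct_mulVec_pos ?_ fun c hc => ?_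
  · ext i j
    simp [gramOf, g.symm x (b j) (b i)]
  · rw [star_trivial, ← inner_sum_sum]
    refine g.pos x _ fun h => hc ?_
    ext i
    exact Fintype.linearIndependent_iff.mp b.linearIndependent c h i

theorem inner_sharp (α : Module.Dual ℝ (TangentSpace (𝓡 n) x)) (v : TangentSpace (𝓡 n) x) :
    g.inner x (sharp g x α) v = α v := by
  have : flat g x (sharp g x α) = α :=
    (LinearMap.linearEquivOfInjective (flat g x) (flat_injective g x)
      Subspace.dual_finrank_eq.symm).apply_symm_apply α
  exact LinearMap.congr_fun this v

theorem dualMetric_eq_apply (α β : Module.Dual ℝ (TangentSpace (𝓡 n) x)) :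
    dualMetric g x α β = α (sharp g x β) := inner_sharp g x α _

theorem dualMetric_symm (α β : Module.Dual ℝ (TangentSpace (𝓡 n) x)) :
    dualMetric g x α β = dualMetric g x β α := g.symm x _ _

theorem dualMetric_pos {α : Module.Dual ℝ (TangentSpace (𝓡 n) x)} (hα : α ≠ 0) :
    0 < dualMetric g x α α :=
  g.pos x _ fun h => hα ((sharp g x).map_eq_zero_iff.mp h)

theorem dualMetric_eq_sum (b : Module.Basis (Fin n) ℝ (TangentSpace (𝓡 n) x))
    (α β : Module.Dual ℝ (TangentSpace (𝓡 n) x)) :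
    dualMetric g x α β = ∑ i, ∑ j, (gramOf g x b)⁻¹ i j * β (b j) * α (b i) := by
  -- The coordinates of the raised covector solve the linear system with the Gram matrix; inverting
  -- it produces the `g^ij`.
  have hβ : (gramOf g x b).mulVec (b.repr (sharp g x β)) = fun i => β (b i) := by
    ext i
    have h := inner_sum_sum g x b (Pi.single i 1) (b.repr (sharp g x β))
    rw [b.sum_repr, single_one_dotProduct] at h
    rw [← h, ← inner_sharp g x β, g.symm]
    congr 2
    simp [Pi.single_apply]
  have hs : ⇑(b.repr (sharp g x β)) = (gramOf g x b)⁻¹.mulVec fun i => β (b i) := by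
    rw [← hβ, Matrix.mulVec_mulVec,
      Matrix.nonsing_inv_mul _ (gramOf_posDef g x b).det_pos.ne'.isUnit, Matrix.one_mulVec]
  rw [dualMetric_eq_apply]
  conv_lhs => rw [← b.sum_repr (sharp g x β), map_sum]
  refine Finset.sum_congr rfl fun i _ => ?_
  rw [map_smul, hs, smul_eq_mul, Matrix.mulVec, dotProduct, Finset.sum_mul]

end LinearAlgebra

theorem isInvertible_mfderiv_chart_symm {p : N} {y : EuclideanSpace ℝ (Fin n)}
    (hy : y ∈ (extChartAt (𝓡 n) p).target) :
    (mfderiv 𝓘(ℝ, EuclideanSpace ℝ (Fin n)) (𝓡 n) (extChartAt (𝓡 n) p).symm y).IsInvertible := by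
  have := isInvertible_mfderivWithin_extChartAt_symm (I := 𝓡 n) hy
  rwa [ModelWithCorners.range_eq_univ, mfderivWithin_univ] at this

theorem exists_coordBasis {p : N} {y : EuclideanSpace ℝ (Fin n)}
    (hy : y ∈ (extChartAt (𝓡 n) p).target) :
    ∃ b : Module.Basis (Fin n) ℝ (TangentSpace (𝓡 n) ((extChartAt (𝓡 n) p).symm y)),
      ∀ i, b i = coordVec p y i := by
  obtain ⟨e, he⟩ := isInvertible_mfderiv_chart_symm hy
  let e' : EuclideanSpace ℝ (Fin n) ≃ₗ[ℝ]
    TangentSpace (𝓡 n) ((extChartAt (𝓡 n) p).symm y) := e.toLinearEquiv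
  refine ⟨(EuclideanSpace.basisFun (Fin n) ℝ).toBasis.map e', fun i => ?_⟩
  rw [Module.Basis.map_apply, OrthonormalBasis.coe_toBasis, EuclideanSpace.basisFun_apply,
    coordVec, ← he]
  rfl

/-- The coordinate vector fields form a basis of the tangent space. -/
def coordBasis {p : N} {y : EuclideanSpace ℝ (Fin n)}
    (hy : y ∈ (extChartAt (𝓡 n) p).target) :
    Module.Basis (Fin n) ℝ (TangentSpace (𝓡 n) ((extChartAt (𝓡 n) p).symm y)) :=
  (exists_coordBasis hy).choose

theorem coordBasis_apply {p : N} {y : EuclideanSpace ℝ (Fin n)}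
    (hy : y ∈ (extChartAt (𝓡 n) p).target) (i : Fin n) : coordBasis hy i = coordVec p y i :=
  (exists_coordBasis hy).choose_spec i

theorem contMDiffOn_chart_symm (p : N) :
    ContMDiffOn 𝓘(ℝ, EuclideanSpace ℝ (Fin n)) (𝓡 n) ∞ (extChartAt (𝓡 n) p).symm
      (extChartAt (𝓡 n) p).target := contMDiffOn_extChartAt_symm p

/-- The field is the tangent map of the inverse chart composed with a constant section of the model
space. -/
theorem contMDiffOn_coordVec (p : N) (i : Fin n) :
    ContMDiffOn 𝓘(ℝ, EuclideanSpace ℝ (Fin n)) (𝓡 n).tangent ∞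
      (fun y => (⟨(extChartAt (𝓡 n) p).symm y, coordVec p y i⟩ : TangentBundle (𝓡 n) N))
      (extChartAt (𝓡 n) p).target := by
  have h := ContMDiffOn.contMDiffOn_tangentMapWithin (m := ∞) (n := ∞) (contMDiffOn_chart_symm (n := n) p) (by simp)
    (isOpen_extChartAt_target p).uniqueMDiffOn
  have hs : ContMDiff 𝓘(ℝ, EuclideanSpace ℝ (Fin n)) (𝓘(ℝ, EuclideanSpace ℝ (Fin n))).tangent ∞
      (fun y => (⟨y, EuclideanSpace.single i (1 : ℝ)⟩ :
        TangentBundle 𝓘(ℝ, EuclideanSpace ℝ (Fin n)) (EuclideanSpace ℝ (Fin n)))) :=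
    contMDiff_vectorSpace_iff_contDiff.mpr contDiff_const
  refine (h.comp hs.contMDiffOn fun y hy => hy).congr fun y hy => ?_
  simp only [Function.comp_apply, tangentMapWithin, coordVec]
  rw [mfderivWithin_of_isOpen (isOpen_extChartAt_target p) hy]

theorem contDiffOn_gram (g : Metric n N) (p : N) (i j : Fin n) :
    ContDiffOn ℝ ∞ (fun y => gram g p y i j) (extChartAt (𝓡 n) p).target := by
  rw [← contMDiffOn_iff_contDiffOn]
  have h := ContMDiffOn.clm_bundle_apply₂ (n := ∞) (b := (extChartAt (𝓡 n) p).symm)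
    (s := (extChartAt (𝓡 n) p).target) (E₃ := Bundle.Trivial N ℝ) (F₃ := ℝ)
    (ψ := fun y => g.inner ((extChartAt (𝓡 n) p).symm y))
    (g.contMDiff.comp_contMDiffOn (contMDiffOn_chart_symm p)) (contMDiffOn_coordVec p i)
    (contMDiffOn_coordVec p j)
  intro y hy
  have := h y hy
  rw [Bundle.contMDiffWithinAt_totalSpace] at this
  exact this.2

theorem gram_eq (g : Metric n N) {p : N} {y : EuclideanSpace ℝ (Fin n)}
    (hy : y ∈ (extChartAt (𝓡 n) p).target) : gram g p y = gramOf g _ (coordBasis hy) := by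
  ext i j
  simp only [gram, gramOf, Matrix.of_apply, coordBasis_apply]

theorem gram_posDef (g : Metric n N) {p : N} {y : EuclideanSpace ℝ (Fin n)}
    (hy : y ∈ (extChartAt (𝓡 n) p).target) : (gram g p y).PosDef :=
  gram_eq g hy ▸ gramOf_posDef g _ _

theorem density_pos (g : Metric n N) {p : N} {y : EuclideanSpace ℝ (Fin n)}
    (hy : y ∈ (extChartAt (𝓡 n) p).target) : 0 < density g p y :=
  Real.sqrt_pos.mpr (gram_posDef g hy).det_pos

theorem contDiffOn_density (g : Metric n N) (p : N) :
    ContDiffOn ℝ ∞ (density g p) (extChartAt (𝓡 n) p).target :=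
  (contDiffOn_det (contDiffOn_gram g p)).sqrt fun _ hy => (gram_posDef g hy).det_pos.ne'

theorem contDiffOn_gram_inv (g : Metric n N) (p : N) (i j : Fin n) :
    ContDiffOn ℝ ∞ (fun y => (gram g p y)⁻¹ i j) (extChartAt (𝓡 n) p).target :=
  contDiffOn_inv_apply (contDiffOn_gram g p) (fun _ hy => (gram_posDef g hy).det_pos.ne') i j

end Chart

/-! ### The Laplacian and the gradient product in a chart -/

section ChartLaplacian

variable {n : ℕ} {N : Type*} [TopologicalSpace N] [ChartedSpace (EuclideanSpace ℝ (Fin n)) N]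
  [IsManifold (𝓡 n) ∞ N] {𝕜 : Type*} [RCLike 𝕜]

/-- The differential of a real function, as a covector. -/
def differential (u : N → ℝ) (x : N) : Module.Dual ℝ (TangentSpace (𝓡 n) x) :=
  (mfderiv (𝓡 n) 𝓘(ℝ, ℝ) u x).toLinearMap

/-- The pointwise inner product of the differentials of two functions. -/
def gradInner (g : Metric n N) (u v : N → ℝ) (x : N) : ℝ :=
  dualMetric g x (differential v x) (differential u x)

/-- The components `√det g ∑_j g^ij ∂_j u` of the gradient density in a chart. -/
def flux (g : Metric n N) (p : N) (u : N → 𝕜) (i : Fin n) (y : EuclideanSpace ℝ (Fin n)) : 𝕜 :=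
  density g p y •
    ∑ j, ((gram g p y)⁻¹ i j) • partialDeriv j (u ∘ (extChartAt (𝓡 n) p).symm) y

/-- The coordinate expression of the Laplacian in the preferred chart at `p`. -/
def chartLaplacian (g : Metric n N) (p : N) (u : N → 𝕜) (y : EuclideanSpace ℝ (Fin n)) : 𝕜 :=
  (density g p y)⁻¹ • ∑ i, partialDeriv i (flux g p u i) y

theorem laplacian_eq (g : Metric n N) (u : N → 𝕜) (x : N) :
    laplacian g u x = chartLaplacian g x u (extChartAt (𝓡 n) x x) := rfl

theorem contDiffOn_partialDeriv {s : Set (EuclideanSpace ℝ (Fin n))} (hs : IsOpen s)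
    {f : EuclideanSpace ℝ (Fin n) → 𝕜} (hf : ContDiffOn ℝ ∞ f s) (i : Fin n) :
    ContDiffOn ℝ ∞ (partialDeriv i f) s :=
  (hf.fderiv_of_isOpen hs (m := ∞) (by simp)).clm_apply contDiffOn_const

theorem contDiffOn_comp_chart_symm {u : N → 𝕜} (hu : ContMDiff (𝓡 n) 𝓘(ℝ, 𝕜) ∞ u) (p : N) :
    ContDiffOn ℝ ∞ (u ∘ (extChartAt (𝓡 n) p).symm) (extChartAt (𝓡 n) p).target := by
  rw [← contMDiffOn_iff_contDiffOn]
  exact hu.comp_contMDiffOn (contMDiffOn_chart_symm p)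

theorem contDiffOn_flux (g : Metric n N) (p : N) {u : N → 𝕜}
    (hu : ContMDiff (𝓡 n) 𝓘(ℝ, 𝕜) ∞ u) (i : Fin n) :
    ContDiffOn ℝ ∞ (flux g p u i) (extChartAt (𝓡 n) p).target :=
  (contDiffOn_density g p).smul <| ContDiffOn.sum fun j _ =>
    (contDiffOn_gram_inv g p i j).smul <| contDiffOn_partialDeriv (isOpen_extChartAt_target p)
      (contDiffOn_comp_chart_symm hu p) j

theorem continuousOn_chartLaplacian (g : Metric n N) (p : N) {u : N → 𝕜}
    (hu : ContMDiff (𝓡 n) 𝓘(ℝ, 𝕜) ∞ u) :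
    ContinuousOn (chartLaplacian g p u) (extChartAt (𝓡 n) p).target :=
  ((contDiffOn_density g p).continuousOn.inv₀ fun _ hy => (density_pos g hy).ne').smul <|
    continuousOn_finsetSum _ fun i _ =>
      (contDiffOn_partialDeriv (isOpen_extChartAt_target p) (contDiffOn_flux g p hu i)
        i).continuousOn

theorem differential_coordVec {u : N → ℝ} (hu : ContMDiff (𝓡 n) 𝓘(ℝ, ℝ) ∞ u) {p : N}
    {y : EuclideanSpace ℝ (Fin n)} (hy : y ∈ (extChartAt (𝓡 n) p).target) (i : Fin n) :
    differential u _ (coordVec p y i) =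
      partialDeriv i (u ∘ (extChartAt (𝓡 n) p).symm) y := by
  have h1 : MDifferentiableAt (𝓡 n) 𝓘(ℝ, ℝ) u ((extChartAt (𝓡 n) p).symm y) :=
    (hu _).mdifferentiableAt (by simp)
  have h2 : MDifferentiableAt 𝓘(ℝ, EuclideanSpace ℝ (Fin n)) (𝓡 n)
      (extChartAt (𝓡 n) p).symm y :=
    ((contMDiffOn_chart_symm p).contMDiffAt
      ((isOpen_extChartAt_target p).mem_nhds hy)).mdifferentiableAt (by simp)
  rw [partialDeriv, ← mfderiv_eq_fderiv, mfderiv_comp y h1 h2]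
  rfl

/-- The inner product of differentials in a chart. -/
theorem density_mul_gradInner (g : Metric n N) {u v : N → ℝ}
    (hu : ContMDiff (𝓡 n) 𝓘(ℝ, ℝ) ∞ u) (hv : ContMDiff (𝓡 n) 𝓘(ℝ, ℝ) ∞ v) {p : N}
    {y : EuclideanSpace ℝ (Fin n)} (hy : y ∈ (extChartAt (𝓡 n) p).target) :
    density g p y * gradInner g u v ((extChartAt (𝓡 n) p).symm y) =
      ∑ i, flux g p u i y * partialDeriv i (v ∘ (extChartAt (𝓡 n) p).symm) y := by
  rw [gradInner, dualMetric_eq_sum g _ (coordBasis hy), ← gram_eq g hy]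
  simp only [coordBasis_apply, differential_coordVec hu hy, differential_coordVec hv hy, flux,
    smul_eq_mul, Finset.mul_sum, Finset.sum_mul]
  exact Finset.sum_congr rfl fun i _ => Finset.sum_congr rfl fun j _ => by ring

/-- Near `p` the intrinsically defined product equals its expression in the one chart at `p`, whose
ingredients are smooth. -/
theorem continuous_gradInner (g : Metric n N) {u v : N → ℝ}
    (hu : ContMDiff (𝓡 n) 𝓘(ℝ, ℝ) ∞ u) (hv : ContMDiff (𝓡 n) 𝓘(ℝ, ℝ) ∞ v) :
    Continuous (gradInner g u v) := by
  rw [continuous_iff_continuousAt]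
  intro p
  have hc : ContinuousOn (fun y => (density g p y)⁻¹ *
      ∑ i, flux g p u i y * partialDeriv i (v ∘ (extChartAt (𝓡 n) p).symm) y)
      (extChartAt (𝓡 n) p).target :=
    ((contDiffOn_density g p).continuousOn.inv₀ fun _ hy => (density_pos g hy).ne').mul <|
      continuousOn_finsetSum _ fun i _ => (contDiffOn_flux g p hu i).continuousOn.mul
        (contDiffOn_partialDeriv (isOpen_extChartAt_target p)
          (contDiffOn_comp_chart_symm hv p) i).continuousOn
  have hs := (isOpen_extChartAt_source (I := 𝓡 n) p).mem_nhds (mem_extChartAt_source p)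
  refine ((hc.comp (continuousOn_extChartAt p) fun x hx =>
    (extChartAt (𝓡 n) p).map_source hx).continuousAt hs).congr ?_
  filter_upwards [hs] with x hx
  have hy := (extChartAt (𝓡 n) p).map_source hx
  simp only [Function.comp_apply]
  rw [← density_mul_gradInner g hu hv hy, (extChartAt (𝓡 n) p).left_inv hx,
    inv_mul_cancel_left₀ (density_pos g hy).ne']

end ChartLaplacian

/-! ### Change of charts -/

section Transition

variable {n : ℕ} {N : Type*} [TopologicalSpace N] [ChartedSpace (EuclideanSpace ℝ (Fin n)) N]

/-- The transition map from the preferred chart at `p` to that at `q`. -/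
def transition (p q : N) (y : EuclideanSpace ℝ (Fin n)) : EuclideanSpace ℝ (Fin n) :=
  extChartAt (𝓡 n) q ((extChartAt (𝓡 n) p).symm y)

/-- The domain of the transition map. -/
def overlap (p q : N) : Set (EuclideanSpace ℝ (Fin n)) :=
  (extChartAt (𝓡 n) p).target ∩ (extChartAt (𝓡 n) p).symm ⁻¹' (extChartAt (𝓡 n) q).source

theorem isOpen_overlap (p q : N) : IsOpen (overlap (n := n) p q) :=
  (continuousOn_extChartAt_symm p).isOpen_inter_preimage (isOpen_extChartAt_target p)
    (isOpen_extChartAt_source q)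

theorem chart_symm_transition {p q : N} {y : EuclideanSpace ℝ (Fin n)} (hy : y ∈ overlap p q) :
    (extChartAt (𝓡 n) q).symm (transition p q y) = (extChartAt (𝓡 n) p).symm y :=
  (extChartAt (𝓡 n) q).left_inv hy.2

theorem transition_mem {p q : N} {y : EuclideanSpace ℝ (Fin n)} (hy : y ∈ overlap p q) :
    transition p q y ∈ overlap q p := by
  refine ⟨(extChartAt (𝓡 n) q).map_source hy.2, ?_⟩
  rw [Set.mem_preimage, chart_symm_transition hy]
  exact (extChartAt (𝓡 n) p).map_target hy.1

theorem transition_transition {p q : N} {y : EuclideanSpace ℝ (Fin n)} (hy : y ∈ overlap p q) :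
    transition q p (transition p q y) = y := by
  rw [transition, chart_symm_transition hy]
  exact (extChartAt (𝓡 n) p).right_inv hy.1

variable [IsManifold (𝓡 n) ∞ N]

/-- The derivative of the inverse chart, as a map from the model space to itself. -/
def chartSymmDeriv (p : N) (y : EuclideanSpace ℝ (Fin n)) :
    EuclideanSpace ℝ (Fin n) →L[ℝ] EuclideanSpace ℝ (Fin n) :=
  mfderiv 𝓘(ℝ, EuclideanSpace ℝ (Fin n)) (𝓡 n) (extChartAt (𝓡 n) p).symm y

theorem mdifferentiableAt_chart_symm {p : N} {y : EuclideanSpace ℝ (Fin n)}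
    (hy : y ∈ (extChartAt (𝓡 n) p).target) :
    MDifferentiableAt 𝓘(ℝ, EuclideanSpace ℝ (Fin n)) (𝓡 n) (extChartAt (𝓡 n) p).symm y :=
  ((contMDiffOn_chart_symm p).contMDiffAt
    ((isOpen_extChartAt_target p).mem_nhds hy)).mdifferentiableAt (by simp)

theorem mdifferentiableAt_chart {q x : N} (hx : x ∈ (extChartAt (𝓡 n) q).source) :
    MDifferentiableAt (𝓡 n) 𝓘(ℝ, EuclideanSpace ℝ (Fin n)) (extChartAt (𝓡 n) q) x :=
  mdifferentiableAt_extChartAt (by simpa using hx)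

theorem differentiableAt_transition {p q : N} {y : EuclideanSpace ℝ (Fin n)}
    (hy : y ∈ overlap p q) : DifferentiableAt ℝ (transition (n := n) p q) y := by
  rw [← mdifferentiableAt_iff_differentiableAt]
  exact (mdifferentiableAt_chart hy.2).comp y (mdifferentiableAt_chart_symm hy.1)

/-- The chain rule for the inverse chart at `q` after the transition map, which near `y` is the
inverse chart at `p`. -/
theorem chartSymmDeriv_transition {p q : N} {y : EuclideanSpace ℝ (Fin n)}
    (hy : y ∈ overlap p q) (v : EuclideanSpace ℝ (Fin n)) :
    chartSymmDeriv q (transition p q y) (fderiv ℝ (transition p q) y v) =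
      chartSymmDeriv p y v := by
  have h := mdifferentiableAt_chart_symm (transition_mem hy).1
  have hd : MDifferentiableAt 𝓘(ℝ, EuclideanSpace ℝ (Fin n)) 𝓘(ℝ, EuclideanSpace ℝ (Fin n))
    (transition (n := n) p q) y := (differentiableAt_transition hy).mdifferentiableAt
  have hcomp := mfderiv_comp y h hd
  have heq : (extChartAt (𝓡 n) q).symm ∘ transition p q =ᶠ[𝓝 y] (extChartAt (𝓡 n) p).symm := by
    filter_upwards [(isOpen_overlap p q).mem_nhds hy] with z hz
    exact chart_symm_transition hz
  rw [heq.mfderiv_eq, mfderiv_eq_fderiv] at hcomp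
  exact (DFunLike.congr_fun hcomp v).symm

theorem gram_transition (g : Metric n N) {p q : N} {y : EuclideanSpace ℝ (Fin n)}
    (hy : y ∈ overlap p q) :
    gram g p y =
      (LinearMap.toMatrix (EuclideanSpace.basisFun (Fin n) ℝ).toBasis
        (EuclideanSpace.basisFun (Fin n) ℝ).toBasis
        (fderiv ℝ (transition p q) y).toLinearMap).transpose *
      gram g q (transition p q y) *
      LinearMap.toMatrix (EuclideanSpace.basisFun (Fin n) ℝ).toBasis
        (EuclideanSpace.basisFun (Fin n) ℝ).toBasis
        (fderiv ℝ (transition p q) y).toLinearMap := by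
  -- With all tangent spaces read as the model space, the base point can be rewritten without
  -- transporting vectors between types.
  let G : N → EuclideanSpace ℝ (Fin n) → EuclideanSpace ℝ (Fin n) → ℝ :=
    fun z a b => g.inner z a b
  let J := fderiv ℝ (transition (n := n) p q) y
  have hD : ∀ i, chartSymmDeriv p y (EuclideanSpace.single i 1) =
      ∑ k, J (EuclideanSpace.single i 1) k •
        chartSymmDeriv q (transition p q y) (EuclideanSpace.single k 1) := by
    intro i
    rw [← chartSymmDeriv_transition hy]
    conv_lhs => rw [← (EuclideanSpace.basisFun (Fin n) ℝ).sum_repr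
      (fderiv ℝ (transition p q) y (EuclideanSpace.single i 1))]
    rw [map_sum]
    refine Finset.sum_congr rfl fun k _ => ?_
    rw [map_smul, EuclideanSpace.basisFun_repr, EuclideanSpace.basisFun_apply]
  ext i j
  have h1 : gram g p y i j = G ((extChartAt (𝓡 n) p).symm y)
      (chartSymmDeriv p y (EuclideanSpace.single i 1))
      (chartSymmDeriv p y (EuclideanSpace.single j 1)) := rfl
  have h2 := inner_sum_sum g _ (coordVec q (transition p q y))
    (fun k => J (EuclideanSpace.single i 1) k) (fun k => J (EuclideanSpace.single j 1) k)
  rw [h1, hD, hD, ← chart_symm_transition hy]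
  refine h2.trans ?_
  rw [Matrix.mul_assoc, Matrix.mul_apply, dotProduct]
  refine Finset.sum_congr rfl fun k _ => ?_
  rw [Matrix.transpose_apply, LinearMap.toMatrix_apply, Matrix.mul_apply, Matrix.mulVec,
    dotProduct]
  simp only [LinearMap.toMatrix_apply, OrthonormalBasis.coe_toBasis,
    EuclideanSpace.basisFun_apply, OrthonormalBasis.coe_toBasis_repr_apply,
    EuclideanSpace.basisFun_repr]
  rfl

theorem density_transition (g : Metric n N) {p q : N} {y : EuclideanSpace ℝ (Fin n)}
    (hy : y ∈ overlap p q) :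
    density g p y = |(fderiv ℝ (transition p q) y).det| * density g q (transition p q y) := by
  rw [density, gram_transition g hy, Matrix.det_mul, Matrix.det_mul, Matrix.det_transpose,
    LinearMap.det_toMatrix, mul_right_comm, Real.sqrt_mul (mul_self_nonneg _),
    Real.sqrt_mul_self_eq_abs]
  rfl

end Transition

/-! ### The Riemannian measure -/

section Measure

open MeasureTheory

variable {n : ℕ} {N : Type*} [TopologicalSpace N] [ChartedSpace (EuclideanSpace ℝ (Fin n)) N]

theorem measurableSet_target (p : N) : MeasurableSet (extChartAt (𝓡 n) p).target :=
  (isOpen_extChartAt_target p).measurableSet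

theorem aemeasurable_density [IsManifold (𝓡 n) ∞ N] (g : Metric n N) (p : N) :
    AEMeasurable (fun y => ENNReal.ofReal (density g p y))
      (volume.restrict (extChartAt (𝓡 n) p).target) :=
  ((contDiffOn_density g p).continuousOn.aemeasurable (measurableSet_target p)).ennreal_ofReal

variable [MeasurableSpace N] [BorelSpace N]

theorem measurableSet_source (p : N) : MeasurableSet (extChartAt (𝓡 n) p).source :=
  (isOpen_extChartAt_source p).measurableSet

theorem aemeasurable_chart_symm (p : N) :
    AEMeasurable (extChartAt (𝓡 n) p).symm (volume.restrict (extChartAt (𝓡 n) p).target) :=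
  (continuousOn_extChartAt_symm p).aemeasurable (measurableSet_target p)

theorem measurableSet_target_inter (p : N) {B : Set N} (hB : MeasurableSet B) :
    MeasurableSet ((extChartAt (𝓡 n) p).target ∩ (extChartAt (𝓡 n) p).symm ⁻¹' B) := by
  have h : Measurable ((extChartAt (𝓡 n) p).target.domRestrict (extChartAt (𝓡 n) p).symm) :=
    (continuousOn_iff_continuous_domRestrict.mp (continuousOn_extChartAt_symm p)).measurable
  have := (measurableSet_target p).subtype_image (h hB)
  convert this using 1
  ext y
  constructor
  · rintro ⟨h1, h2⟩
    exact ⟨⟨y, h1⟩, h2, rfl⟩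
  · rintro ⟨⟨z, hz⟩, h2, rfl⟩
    exact ⟨hz, h2⟩

variable [IsManifold (𝓡 n) ∞ N]

theorem chartVol_apply (g : Metric n N) (p : N) {B : Set N} (hB : MeasurableSet B) :
    chartVol g p B =
      ∫⁻ y in (extChartAt (𝓡 n) p).target ∩ (extChartAt (𝓡 n) p).symm ⁻¹' B,
        ENNReal.ofReal (density g p y) := by
  rw [chartVol, Measure.map_apply_of_aemeasurable ((aemeasurable_chart_symm p).mono_ac
    (withDensity_absolutelyContinuous _ _)) hB, withDensity_apply',
    Measure.restrict_restrict' (measurableSet_target p), Set.inter_comm]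

theorem chartVol_compl_source (g : Metric n N) (p : N) :
    chartVol g p (extChartAt (𝓡 n) p).sourceᶜ = 0 := by
  rw [chartVol_apply g p (measurableSet_source p).compl]
  have : (extChartAt (𝓡 n) p).target ∩ (extChartAt (𝓡 n) p).symm ⁻¹'
      (extChartAt (𝓡 n) p).sourceᶜ = ∅ := by
    ext y
    simp only [Set.mem_inter_iff, Set.mem_preimage, Set.mem_compl_iff, Set.mem_empty_iff_false,
      iff_false, not_and, not_not]
    exact (extChartAt (𝓡 n) p).map_target
  rw [this, Measure.restrict_empty, lintegral_zero_measure]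

theorem chartVol_inter_source (g : Metric n N) (p : N) (B : Set N) :
    chartVol g p (B ∩ (extChartAt (𝓡 n) p).source) = chartVol g p B :=
  measure_inter_conull (chartVol_compl_source g p)

/-- The local measures agree on the overlaps of the charts. -/
theorem chartVol_eq_of_subset (g : Metric n N) {p q : N} {B : Set N} (hB : MeasurableSet B)
    (hp : B ⊆ (extChartAt (𝓡 n) p).source) (hq : B ⊆ (extChartAt (𝓡 n) q).source) :
    chartVol g p B = chartVol g q B := by
  rw [chartVol_apply g p hB, chartVol_apply g q hB]
  set S := (extChartAt (𝓡 n) p).target ∩ (extChartAt (𝓡 n) p).symm ⁻¹' B with hS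
  have hSo : S ⊆ overlap p q := fun y hy => ⟨hy.1, hq hy.2⟩
  have himage : (extChartAt (𝓡 n) q).target ∩ (extChartAt (𝓡 n) q).symm ⁻¹' B =
      transition p q '' S := by
    ext z
    constructor
    · rintro ⟨hz, hzB⟩
      have hzo : z ∈ overlap q p := ⟨hz, hp hzB⟩
      refine ⟨transition q p z, ⟨(transition_mem hzo).1, ?_⟩, transition_transition hzo⟩
      rwa [Set.mem_preimage, chart_symm_transition hzo]
    · rintro ⟨y, hy, rfl⟩
      refine ⟨(transition_mem (hSo hy)).1, ?_⟩
      rw [Set.mem_preimage, chart_symm_transition (hSo hy)]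
      exact hy.2
  have hinj : Set.InjOn (transition (n := n) p q) S := fun y hy z hz h => by
    rw [← transition_transition (hSo hy), h, transition_transition (hSo hz)]
  -- Change of variables along the transition map; its Jacobian is absorbed by `density_transition`.
  rw [himage, lintegral_image_eq_lintegral_abs_det_fderiv_mul volume
    (measurableSet_target_inter p hB)
    (fun y hy => (differentiableAt_transition (hSo hy)).hasFDerivAt.hasFDerivWithinAt) hinj]
  refine setLIntegral_congr_fun (measurableSet_target_inter p hB) fun y hy => ?_
  rw [density_transition g (hSo hy), ENNReal.ofReal_mul (abs_nonneg _)]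

/-- This reduces integrals over `N` to one chart. It rests on the agreement of the chart measures on
overlaps. -/
theorem vol_restrict_source (g : Metric n N) (q : N) :
    (vol g).restrict (extChartAt (𝓡 n) q).source = chartVol g q := by
  set S := (extChartAt (𝓡 n) q).source
  have hS : MeasurableSet S := measurableSet_source q
  -- A supremum of measures is not the setwise supremum, so an upper bound that is itself a measure
  -- is needed: inside `S` each chart measure is dominated by the one at `q`.
  have hle : vol g ≤ chartVol g q + (vol g).restrict Sᶜ := by
    refine iSup_le fun p => Measure.le_iff.mpr fun B hB => ?_
    rw [← measure_inter_add_sdiff B hS, Measure.add_apply]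
    refine add_le_add ?_ ?_
    · rw [← chartVol_inter_source, chartVol_eq_of_subset g ((hB.inter hS).inter
        (measurableSet_source p)) Set.inter_subset_right
        (Set.inter_subset_left.trans Set.inter_subset_right)]
      exact measure_mono (Set.inter_subset_left.trans Set.inter_subset_left)
    · rw [Measure.restrict_apply hB]
      exact le_iSup (chartVol g) p _
  refine le_antisymm (Measure.le_iff.mpr fun B hB => ?_) (Measure.le_iff.mpr fun B hB => ?_)
  · rw [Measure.restrict_apply hB]
    refine (hle _).trans ?_
    rw [Measure.add_apply, Measure.restrict_apply (hB.inter hS), Set.inter_assoc,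
      Set.inter_compl_self, Set.inter_empty, measure_empty, add_zero]
    exact measure_mono Set.inter_subset_left
  · rw [Measure.restrict_apply hB, ← chartVol_inter_source]
    exact le_iSup (chartVol g) q _

/-- Integrals of functions supported in a chart domain. -/
theorem integral_vol_of_support_subset (g : Metric n N) {p : N} {f : N → ℝ}
    (hf : ∀ x, x ∉ (extChartAt (𝓡 n) p).source → f x = 0) (hfm : Measurable f) :
    ∫ x, f x ∂(vol g) = ∫ y in (extChartAt (𝓡 n) p).target,
      density g p y * f ((extChartAt (𝓡 n) p).symm y) := by
  rw [← setIntegral_eq_integral_of_forall_compl_eq_zero hf, vol_restrict_source, chartVol,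
    integral_map ((aemeasurable_chart_symm p).mono_ac (withDensity_absolutelyContinuous _ _))
      hfm.aestronglyMeasurable,
    integral_withDensity_eq_integral_toReal_smul₀ (aemeasurable_density g p)
      (Filter.Eventually.of_forall fun _ => ENNReal.ofReal_lt_top)]
  refine setIntegral_congr_fun (measurableSet_target p) fun y hy => ?_
  simp only [smul_eq_mul]
  rw [ENNReal.toReal_ofReal (density_pos g hy).le]

instance isLocallyFiniteMeasure_vol (g : Metric n N) : IsLocallyFiniteMeasure (vol g) := by
  refine ⟨fun p => ?_⟩
  set φ := extChartAt (𝓡 n) p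
  have hpt : φ p ∈ φ.target := mem_extChartAt_target p
  obtain ⟨K, hK, hKt, hKc⟩ := local_compact_nhds
    ((isOpen_extChartAt_target (I := 𝓡 n) p).mem_nhds hpt)
  refine ⟨φ.source ∩ φ ⁻¹' interior K,
    ((continuousOn_extChartAt p).isOpen_inter_preimage (isOpen_extChartAt_source p)
      isOpen_interior).mem_nhds ⟨mem_extChartAt_source p, mem_interior_iff_mem_nhds.mpr hK⟩, ?_⟩
  set U := φ.source ∩ φ ⁻¹' interior K
  have hU : MeasurableSet U := ((continuousOn_extChartAt p).isOpen_inter_preimage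
    (isOpen_extChartAt_source p) isOpen_interior).measurableSet
  have h1 : vol g U = chartVol g p U := by
    rw [← vol_restrict_source, Measure.restrict_apply hU, Set.inter_eq_left.mpr
      Set.inter_subset_left]
  rw [h1, chartVol_apply g p hU]
  have hsub : φ.target ∩ φ.symm ⁻¹' U ⊆ K := by
    rintro y ⟨hy, hyU⟩
    have := hyU.2
    rw [Set.mem_preimage, φ.right_inv hy] at this
    exact interior_subset this
  refine (lintegral_mono_set hsub).trans_lt ?_
  have hint : IntegrableOn (density g p) K :=
    ((contDiffOn_density g p).continuousOn.mono hKt).integrableOn_compact hKc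
  exact hint.lintegral_lt_top

/-- Needed to turn almost-everywhere equality of continuous functions into equality. -/
instance isOpenPosMeasure_vol (g : Metric n N) : (vol g).IsOpenPosMeasure := by
  refine ⟨fun U hU ⟨p, hp⟩ h0 => ?_⟩
  have h1 : chartVol g p U = 0 := le_antisymm ((le_iSup (chartVol g) p U).trans h0.le) zero_le
  rw [chartVol_apply g p hU.measurableSet, lintegral_eq_zero_iff' ((aemeasurable_density g
    p).mono_measure (Measure.restrict_mono Set.inter_subset_left le_rfl))] at h1
  have hopen : IsOpen ((extChartAt (𝓡 n) p).target ∩ (extChartAt (𝓡 n) p).symm ⁻¹' U) :=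
    (continuousOn_extChartAt_symm p).isOpen_inter_preimage (isOpen_extChartAt_target p) hU
  have hne : volume ((extChartAt (𝓡 n) p).target ∩ (extChartAt (𝓡 n) p).symm ⁻¹' U) ≠ 0 :=
    hopen.measure_ne_zero volume ⟨extChartAt (𝓡 n) p p, mem_extChartAt_target p, by
      simpa using hp⟩
  rw [Filter.EventuallyEq, ae_restrict_iff' (measurableSet_target_inter p hU.measurableSet)] at h1
  refine hne (measure_mono_null (fun y hy => ?_) h1)
  intro h
  have := h hy
  simp only [Pi.zero_apply, ENNReal.ofReal_eq_zero] at this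
  exact absurd (density_pos g hy.1) (not_lt.mpr this)

theorem vol_eq_smul {g₁ g₂ : Metric n N} {c : ℝ} (hc : 0 < c)
    (h : ∀ p : N, ∀ y ∈ (extChartAt (𝓡 n) p).target, density g₁ p y = c * density g₂ p y) :
    vol g₁ = ENNReal.ofReal c • vol g₂ := by
  have hp : ∀ p, chartVol g₁ p = ENNReal.ofReal c • chartVol g₂ p := by
    intro p
    refine Measure.ext fun B hB => ?_
    rw [Measure.smul_apply, chartVol_apply g₁ p hB, chartVol_apply g₂ p hB, smul_eq_mul,
      ← lintegral_const_mul' _ _ ENNReal.ofReal_ne_top]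
    refine setLIntegral_congr_fun (measurableSet_target_inter p hB) fun y hy => ?_
    rw [h p y hy.1, ENNReal.ofReal_mul hc.le]
  have h0 : ENNReal.ofReal c ≠ 0 := (ENNReal.ofReal_pos.mpr hc).ne'
  refine le_antisymm (iSup_le fun p => ?_) ?_
  · rw [hp]
    exact Measure.le_iff.mpr fun B _ => by
      simp only [Measure.smul_apply]
      gcongr
      exact le_iSup (chartVol g₂) p
  · have hle : vol g₂ ≤ (ENNReal.ofReal c)⁻¹ • vol g₁ := iSup_le fun p =>
      Measure.le_iff.mpr fun B _ => by
        have h1 : chartVol g₁ p B ≤ vol g₁ B := le_iSup (chartVol g₁) p B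
        rw [hp, Measure.smul_apply, smul_eq_mul] at h1
        rw [Measure.smul_apply, smul_eq_mul, mul_comm, ← div_eq_mul_inv,
          ENNReal.le_div_iff_mul_le (Or.inl h0) (Or.inl ENNReal.ofReal_ne_top), mul_comm]
        exact h1
    refine Measure.le_iff.mpr fun B _ => ?_
    have h1 : vol g₂ B ≤ (ENNReal.ofReal c)⁻¹ * vol g₁ B := hle B
    rw [Measure.smul_apply, smul_eq_mul]
    calc ENNReal.ofReal c * vol g₂ B
        ≤ ENNReal.ofReal c * ((ENNReal.ofReal c)⁻¹ * vol g₁ B) := by gcongr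
      _ = vol g₁ B := by
        rw [← mul_assoc, ENNReal.mul_inv_cancel h0 ENNReal.ofReal_ne_top, one_mul]

end Measure

/-! ### Green's formula -/

section Green

open MeasureTheory

theorem continuous_of_eq_zero_off {X : Type*} [TopologicalSpace X] {f : X → ℝ} {U K : Set X}
    (hU : IsOpen U) (hK : IsClosed K) (hKU : K ⊆ U) (hf : ContinuousOn f U)
    (h0 : ∀ x ∉ K, f x = 0) : Continuous f := by
  rw [continuous_iff_continuousAt]
  intro x
  by_cases hx : x ∈ K
  · exact hf.continuousAt (hU.mem_nhds (hKU hx))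
  · refine (continuousAt_const (y := (0 : ℝ))).congr ?_
    filter_upwards [hK.isOpen_compl.mem_nhds hx] with z hz
    exact (h0 z hz).symm

theorem contDiff_of_eq_zero_off {E : Type*} [NormedAddCommGroup E] [NormedSpace ℝ E] {f : E → ℝ}
    {U K : Set E} (hU : IsOpen U) (hK : IsClosed K) (hKU : K ⊆ U) (hf : ContDiffOn ℝ ∞ f U)
    (h0 : ∀ x ∉ K, f x = 0) : ContDiff ℝ ∞ f := by
  rw [contDiff_iff_contDiffAt]
  intro x
  by_cases hx : x ∈ K
  · exact hf.contDiffAt (hU.mem_nhds (hKU hx))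
  · refine (contDiffAt_const (c := (0 : ℝ))).congr_of_eventuallyEq ?_
    filter_upwards [hK.isOpen_compl.mem_nhds hx] with z hz
    exact h0 z hz

theorem integral_partialDeriv_eq_zero {n : ℕ} {w : EuclideanSpace ℝ (Fin n) → ℝ}
    (hw : ContDiff ℝ ∞ w) (hc : HasCompactSupport w) (i : Fin n) :
    Integrable (partialDeriv i w) ∧ ∫ y, partialDeriv i w y = 0 := by
  have hcont : Continuous (partialDeriv i w) :=
    (hw.continuous_fderiv (by simp)).clm_apply continuous_const
  have hint : Integrable (partialDeriv i w) :=
    hcont.integrable_of_hasCompactSupport (hc.fderiv_apply ℝ _)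
  refine ⟨hint, ?_⟩
  -- Integration by parts against the constant function `1`.
  have := integral_mul_fderiv_eq_neg_fderiv_mul_of_integrable (μ := volume)
    (f := fun _ : EuclideanSpace ℝ (Fin n) => (1 : ℝ)) (g := w)
    (v := EuclideanSpace.single i (1 : ℝ)) (by simp) (by simp only [one_mul]; exact hint)
    (by simpa using hw.continuous.integrable_of_hasCompactSupport hc)
    (fun _ _ => differentiableAt_const _) (fun x _ => hw.contDiffAt.differentiableAt (by simp))
  simpa [partialDeriv] using this

variable {n : ℕ} {N : Type*} [TopologicalSpace N] [ChartedSpace (EuclideanSpace ℝ (Fin n)) N]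

theorem differential_eq_zero {v : N → ℝ} {x : N} (hx : x ∉ tsupport v) :
    differential (n := n) v x = 0 := by
  have h : v =ᶠ[𝓝 x] fun _ => (0 : ℝ) := notMem_tsupport_iff_eventuallyEq.mp hx
  rw [differential, h.mfderiv_eq, mfderiv_const]
  rfl

theorem differential_add {v w : N → ℝ} (hv : ContMDiff (𝓡 n) 𝓘(ℝ, ℝ) ∞ v)
    (hw : ContMDiff (𝓡 n) 𝓘(ℝ, ℝ) ∞ w) (x : N) :
    differential (n := n) (v + w) x = differential v x + differential w x := by
  rw [differential, mfderiv_add ((hv x).mdifferentiableAt (by simp))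
    ((hw x).mdifferentiableAt (by simp))]
  rfl

variable [IsManifold (𝓡 n) ∞ N]

theorem gradInner_eq_zero (g : Metric n N) (u : N → ℝ) {v : N → ℝ} {x : N}
    (hx : x ∉ tsupport v) : gradInner g u v x = 0 := by
  rw [gradInner, differential_eq_zero hx, dualMetric_eq_apply, LinearMap.zero_apply]

theorem continuous_chartLaplacian_mul (g : Metric n N) {p : N} {u v : N → ℝ}
    (hu : ContMDiff (𝓡 n) 𝓘(ℝ, ℝ) ∞ u) (hv : ContMDiff (𝓡 n) 𝓘(ℝ, ℝ) ∞ v)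
    (hvp : tsupport v ⊆ (extChartAt (𝓡 n) p).source) :
    Continuous fun x => chartLaplacian g p u (extChartAt (𝓡 n) p x) * v x := by
  refine continuous_of_eq_zero_off (isOpen_extChartAt_source (I := 𝓡 n) p) (isClosed_tsupport v)
    hvp ?_ fun x hx => by rw [image_eq_zero_of_notMem_tsupport hx, mul_zero]
  exact ((continuousOn_chartLaplacian g p hu).comp (continuousOn_extChartAt p) fun x hx =>
    (extChartAt (𝓡 n) p).map_source hx).mul hv.continuous.continuousOn

theorem gradInner_add (g : Metric n N) (u : N → ℝ) {v w : N → ℝ}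
    (hv : ContMDiff (𝓡 n) 𝓘(ℝ, ℝ) ∞ v) (hw : ContMDiff (𝓡 n) 𝓘(ℝ, ℝ) ∞ w) (x : N) :
    gradInner g u (v + w) x = gradInner g u v x + gradInner g u w x := by
  simp only [gradInner, dualMetric_eq_apply, differential_add hv hw, LinearMap.add_apply]

variable [MeasurableSpace N] [BorelSpace N]

/-- Green's formula in a chart. -/
theorem integral_chartLaplacian_mul_add_gradInner (g : Metric n N) {p : N} {u v : N → ℝ}
    (hu : ContMDiff (𝓡 n) 𝓘(ℝ, ℝ) ∞ u) (hv : ContMDiff (𝓡 n) 𝓘(ℝ, ℝ) ∞ v)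
    (hvc : HasCompactSupport v) (hvp : tsupport v ⊆ (extChartAt (𝓡 n) p).source) :
    ∫ x, (chartLaplacian g p u (extChartAt (𝓡 n) p x) * v x + gradInner g u v x) ∂(vol g) = 0 := by
  set φ := extChartAt (𝓡 n) p with hφ
  have hT : IsOpen φ.target := isOpen_extChartAt_target p
  set K := φ '' tsupport v with hK
  have hKc : IsCompact K := hvc.isCompact.image_of_continuousOn
    ((continuousOn_extChartAt p).mono hvp)
  have hKT : K ⊆ φ.target := by
    rintro _ ⟨x, hx, rfl⟩
    exact φ.map_source (hvp hx)
  have hvK : ∀ y ∈ φ.target, y ∉ K → v (φ.symm y) = 0 := fun y hy hyK => by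
    refine image_eq_zero_of_notMem_tsupport fun h => hyK ⟨_, h, φ.right_inv hy⟩
  -- The coordinate vector field `√det g · v ∇u`, extended by zero. It is smooth with compact
  -- support, and its divergence is the integrand of Green's formula times the density.
  set w : Fin n → EuclideanSpace ℝ (Fin n) → ℝ :=
    fun i => φ.target.indicator fun y => flux g p u i y * (v ∘ φ.symm) y with hw
  have hw0 : ∀ i, ∀ y ∉ K, w i y = 0 := fun i y hy => by
    by_cases hyT : y ∈ φ.target
    · simp only [hw, Set.indicator_of_mem hyT, Function.comp_apply, hvK y hyT hy, mul_zero]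
    · simp only [hw, Set.indicator_of_notMem hyT]
  have hwd : ∀ i, ContDiff ℝ ∞ (w i) := fun i => by
    refine contDiff_of_eq_zero_off hT hKc.isClosed hKT ?_ (hw0 i)
    exact ((contDiffOn_flux g p hu i).mul (contDiffOn_comp_chart_symm hv p)).congr
      fun y hy => Set.indicator_of_mem hy _
  have hwc : ∀ i, HasCompactSupport (w i) := fun i => HasCompactSupport.intro hKc (hw0 i)
  have hdw : ∀ i, ∀ y ∈ φ.target, partialDeriv i (w i) y =
      partialDeriv i (flux g p u i) y * v (φ.symm y) +
        flux g p u i y * partialDeriv i (v ∘ φ.symm) y := fun i y hy => by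
    have he : w i =ᶠ[𝓝 y] fun y => flux g p u i y * (v ∘ φ.symm) y := by
      filter_upwards [hT.mem_nhds hy] with z hz
      exact Set.indicator_of_mem hz _
    have h1 : DifferentiableAt ℝ (flux g p u i) y :=
      ((contDiffOn_flux g p hu i).contDiffAt (hT.mem_nhds hy)).differentiableAt (by simp)
    have h2 : DifferentiableAt ℝ (v ∘ φ.symm) y :=
      ((contDiffOn_comp_chart_symm hv p).contDiffAt (hT.mem_nhds hy)).differentiableAt (by simp)
    rw [partialDeriv, he.fderiv_eq, fderiv_fun_mul h1 h2]
    simp only [add_apply, smul_apply, smul_eq_mul, partialDeriv, Function.comp_apply]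
    ring
  have hdw0 : ∀ i, ∀ y ∉ φ.target, partialDeriv i (w i) y = 0 := fun i y hy => by
    have : y ∉ tsupport (w i) := fun h =>
      hy (hKT (closure_minimal (fun z hz => by_contra fun hzK => Function.mem_support.mp hz (hw0 i z hzK))
        hKc.isClosed h))
    have h0 : w i =ᶠ[𝓝 y] fun _ => (0 : ℝ) := notMem_tsupport_iff_eventuallyEq.mp this
    rw [partialDeriv, h0.fderiv_eq]
    simp
  rw [integral_vol_of_support_subset g (p := p)]
  · have hsum : ∀ y ∈ φ.target, density g p y *
        (chartLaplacian g p u (φ (φ.symm y)) * v (φ.symm y) + gradInner g u v (φ.symm y)) =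
        ∑ i, partialDeriv i (w i) y := fun y hy => by
      rw [mul_add, density_mul_gradInner g hu hv hy, φ.right_inv hy, chartLaplacian, smul_eq_mul,
        ← mul_assoc, mul_inv_cancel_left₀ (density_pos g hy).ne', Finset.sum_mul,
        ← Finset.sum_add_distrib]
      exact Finset.sum_congr rfl fun i _ => (hdw i y hy).symm
    rw [setIntegral_congr_fun (measurableSet_target p) hsum,
      integral_finsetSum _ fun i _ =>
        (integral_partialDeriv_eq_zero (hwd i) (hwc i) i).1.integrableOn]
    refine Finset.sum_eq_zero fun i _ => ?_
    rw [setIntegral_eq_integral_of_forall_compl_eq_zero (hdw0 i)]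
    exact (integral_partialDeriv_eq_zero (hwd i) (hwc i) i).2
  · intro x hx
    have hx' : x ∉ tsupport v := fun h => hx (hvp h)
    rw [image_eq_zero_of_notMem_tsupport hx', gradInner_eq_zero g u hx', mul_zero, add_zero]
  · exact ((continuous_chartLaplacian_mul g hu hv hvp).add
      (continuous_gradInner g hu hv)).measurable

theorem integrable_gradInner [CompactSpace N] (g : Metric n N) {u v : N → ℝ}
    (hu : ContMDiff (𝓡 n) 𝓘(ℝ, ℝ) ∞ u) (hv : ContMDiff (𝓡 n) 𝓘(ℝ, ℝ) ∞ v) :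
    Integrable (gradInner g u v) (vol g) :=
  (continuous_gradInner g hu hv).integrable_of_hasCompactSupport
    (HasCompactSupport.of_compactSpace _)

variable [T2Space N] [CompactSpace N]

/-- Coordinate independence is obtained weakly, without transforming second derivatives: tested
against any `v` supported in the overlap, both expressions give minus the integral of the intrinsic
`gradInner`. Their difference is thus zero almost everywhere, and everywhere by continuity. -/
theorem chartLaplacian_eq_chartLaplacian (g : Metric n N) {p q : N} {u : N → ℝ}
    (hu : ContMDiff (𝓡 n) 𝓘(ℝ, ℝ) ∞ u) {x : N} (hp : x ∈ (extChartAt (𝓡 n) p).source)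
    (hq : x ∈ (extChartAt (𝓡 n) q).source) :
    chartLaplacian g p u (extChartAt (𝓡 n) p x) = chartLaplacian g q u (extChartAt (𝓡 n) q x) := by
  set S := (extChartAt (𝓡 n) p).source ∩ (extChartAt (𝓡 n) q).source with hS
  have hSo : IsOpen S := (isOpen_extChartAt_source p).inter (isOpen_extChartAt_source q)
  have hc : ∀ p : N, ContinuousOn (fun x => chartLaplacian g p u (extChartAt (𝓡 n) p x))
      (extChartAt (𝓡 n) p).source := fun p =>
    (continuousOn_chartLaplacian g p hu).comp (continuousOn_extChartAt p)
      fun x hx => (extChartAt (𝓡 n) p).map_source hx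
  have hcp := (hc p).mono (Set.inter_subset_left : S ⊆ _)
  have hcq := (hc q).mono (Set.inter_subset_right : S ⊆ _)
  have hae := IsOpen.ae_eq_zero_of_integral_contMDiff_smul_eq_zero (𝓡 n) (μ := vol g)
    (f := fun x => chartLaplacian g p u (extChartAt (𝓡 n) p x) -
      chartLaplacian g q u (extChartAt (𝓡 n) q x)) hSo
    ((hcp.sub hcq).locallyIntegrableOn hSo.measurableSet) fun v hv hvc hvS => by
    have hvp := hvS.trans Set.inter_subset_left
    have hvq := hvS.trans Set.inter_subset_right
    have h1 := integral_chartLaplacian_mul_add_gradInner g hu hv hvc hvp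
    have h2 := integral_chartLaplacian_mul_add_gradInner g hu hv hvc hvq
    have hgc : HasCompactSupport (gradInner g u v) :=
      HasCompactSupport.intro hvc.isCompact fun x hx => gradInner_eq_zero g u hx
    have hi : ∀ p : N, tsupport v ⊆ (extChartAt (𝓡 n) p).source →
        Integrable (fun x => chartLaplacian g p u (extChartAt (𝓡 n) p x) * v x +
          gradInner g u v x) (vol g) := fun p hp =>
      ((continuous_chartLaplacian_mul g hu hv hp).integrable_of_hasCompactSupport
        hvc.mul_left).add
        ((continuous_gradInner g hu hv).integrable_of_hasCompactSupport hgc)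
    rw [← sub_self (0 : ℝ)]
    nth_rw 1 [← h1]
    rw [← h2, ← integral_sub (hi p hvp) (hi q hvq)]
    refine integral_congr_ae (Filter.Eventually.of_forall fun x => ?_)
    simp only [smul_eq_mul]
    ring
  have := Measure.eqOn_open_of_ae_eq (μ := vol g)
    ((ae_restrict_iff' hSo.measurableSet).mpr (hae.mono fun x hx hxS => sub_eq_zero.mp (hx hxS)))
    hSo hcp hcq
  exact this ⟨hp, hq⟩

theorem laplacian_eq_chartLaplacian (g : Metric n N) {p : N} {u : N → ℝ}
    (hu : ContMDiff (𝓡 n) 𝓘(ℝ, ℝ) ∞ u) {x : N} (hp : x ∈ (extChartAt (𝓡 n) p).source) :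
    laplacian g u x = chartLaplacian g p u (extChartAt (𝓡 n) p x) :=
  chartLaplacian_eq_chartLaplacian g hu (mem_extChartAt_source x) hp

theorem continuous_laplacian (g : Metric n N) {u : N → ℝ}
    (hu : ContMDiff (𝓡 n) 𝓘(ℝ, ℝ) ∞ u) : Continuous (laplacian g u) := by
  rw [continuous_iff_continuousAt]
  intro p
  have hs := (isOpen_extChartAt_source (I := 𝓡 n) p).mem_nhds (mem_extChartAt_source p)
  have hc := ((continuousOn_chartLaplacian g p hu).comp (continuousOn_extChartAt p)
    fun x hx => (extChartAt (𝓡 n) p).map_source hx).continuousAt hs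
  refine hc.congr ?_
  filter_upwards [hs] with x hx
  exact (laplacian_eq_chartLaplacian g hu hx).symm

theorem integrable_laplacian_mul (g : Metric n N) {u v : N → ℝ}
    (hu : ContMDiff (𝓡 n) 𝓘(ℝ, ℝ) ∞ u) (hv : ContMDiff (𝓡 n) 𝓘(ℝ, ℝ) ∞ v) :
    Integrable (fun x => laplacian g u x * v x) (vol g) :=
  ((continuous_laplacian g hu).mul hv.continuous).integrable_of_hasCompactSupport
    (HasCompactSupport.of_compactSpace _)

theorem integral_laplacian_mul_of_tsupport_subset (g : Metric n N) {p : N} {u v : N → ℝ}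
    (hu : ContMDiff (𝓡 n) 𝓘(ℝ, ℝ) ∞ u) (hv : ContMDiff (𝓡 n) 𝓘(ℝ, ℝ) ∞ v)
    (hvp : tsupport v ⊆ (extChartAt (𝓡 n) p).source) :
    ∫ x, laplacian g u x * v x ∂(vol g) = -∫ x, gradInner g u v x ∂(vol g) := by
  rw [eq_neg_iff_add_eq_zero, ← integral_add (integrable_laplacian_mul g hu hv)
    (integrable_gradInner g hu hv),
    ← integral_chartLaplacian_mul_add_gradInner g hu hv (HasCompactSupport.of_compactSpace _) hvp]
  refine integral_congr_ae (Filter.Eventually.of_forall fun x => ?_)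
  by_cases hx : x ∈ tsupport v
  · simp only [laplacian_eq_chartLaplacian g hu (hvp hx)]
  · simp only [image_eq_zero_of_notMem_tsupport hx, mul_zero]

/-- Green's formula on a compact manifold. -/
theorem integral_laplacian_mul (g : Metric n N) {u v : N → ℝ}
    (hu : ContMDiff (𝓡 n) 𝓘(ℝ, ℝ) ∞ u) (hv : ContMDiff (𝓡 n) 𝓘(ℝ, ℝ) ∞ v) :
    ∫ x, laplacian g u x * v x ∂(vol g) = -∫ x, gradInner g u v x ∂(vol g) := by
  obtain ⟨t, ht⟩ := CompactSpace.elim_nhds_subcover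
    (fun p : N => (extChartAt (𝓡 n) p).source) fun p => extChartAt_source_mem_nhds p
  obtain ⟨ρ, hρ⟩ := SmoothPartitionOfUnity.exists_isSubordinate (𝓡 n) (s := (Set.univ : Set N))
    isClosed_univ (fun p : t => (extChartAt (𝓡 n) (p : N)).source)
    (fun p => isOpen_extChartAt_source _) fun x _ => by
      have : x ∈ ⋃ p ∈ t, (extChartAt (𝓡 n) p).source := ht ▸ Set.mem_univ x
      simpa using this
  have hρv : ∀ i, ContMDiff (𝓡 n) 𝓘(ℝ, ℝ) ∞ fun x => ρ i x * v x := fun i =>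
    (ρ i).contMDiff.mul hv
  have hdec : v = ∑ i, fun x => ρ i x * v x := by
    ext x
    have h1 := ρ.sum_eq_one (Set.mem_univ x)
    rw [finsum_eq_sum_of_fintype] at h1
    rw [Finset.sum_apply, ← Finset.sum_mul, h1, one_mul]
  -- The formula is additive in `v`, so a partition of unity subordinate to finitely many charts
  -- suffices. Smoothness of the partial sums is carried along because additivity requires it.
  have key : ∀ s : Finset t, ContMDiff (𝓡 n) 𝓘(ℝ, ℝ) ∞ (∑ i ∈ s, fun x => ρ i x * v x) ∧
      ∫ x, laplacian g u x * (∑ i ∈ s, fun x => ρ i x * v x) x ∂(vol g) =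
        -∫ x, gradInner g u (∑ i ∈ s, fun x => ρ i x * v x) x ∂(vol g) := by
    classical
    intro s
    induction s using Finset.induction_on with
    | empty =>
      refine ⟨contMDiff_const, ?_⟩
      have h0 : ∀ x, gradInner g u (0 : N → ℝ) x = 0 := fun x =>
        gradInner_eq_zero g u (by simp)
      simp [h0]
    | insert i s hi ih =>
      rw [Finset.sum_insert hi]
      refine ⟨(hρv i).add ih.1, ?_⟩
      have h1 := integral_laplacian_mul_of_tsupport_subset g (p := (i : N)) hu (hρv i)
        ((tsupport_mul_subset_left).trans (hρ i))
      simp only [gradInner_add g u (hρv i) ih.1, Pi.add_apply, mul_add]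
      rw [integral_add (integrable_laplacian_mul g hu (hρv i))
        (integrable_laplacian_mul g hu ih.1), integral_add (integrable_gradInner g hu (hρv i))
        (integrable_gradInner g hu ih.1), h1, ih.2]
      ring
  have := (key Finset.univ).2
  rwa [← hdec] at this

end Green

/-! ### Real or complex functions and the Laplacian as an operator in `L²` -/

section ScalarValued

open MeasureTheory RCLike

variable {n : ℕ} {N : Type*} [TopologicalSpace N] [ChartedSpace (EuclideanSpace ℝ (Fin n)) N]
  {𝕜 𝕜' : Type*} [RCLike 𝕜] [RCLike 𝕜']

theorem partialDeriv_clm_comp (T : 𝕜 →L[ℝ] 𝕜') {f : EuclideanSpace ℝ (Fin n) → 𝕜}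
    {y : EuclideanSpace ℝ (Fin n)} (hf : DifferentiableAt ℝ f y) (i : Fin n) :
    partialDeriv i (fun z => T (f z)) y = T (partialDeriv i f y) := by
  have := (T.hasFDerivAt.comp y hf.hasFDerivAt).fderiv
  rw [partialDeriv, show (fun z => T (f z)) = T ∘ f from rfl, this]
  rfl

theorem partialDeriv_add {f h : EuclideanSpace ℝ (Fin n) → 𝕜}
    {y : EuclideanSpace ℝ (Fin n)} (hf : DifferentiableAt ℝ f y) (hh : DifferentiableAt ℝ h y)
    (i : Fin n) :
    partialDeriv i (f + h) y = partialDeriv i f y + partialDeriv i h y := by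
  rw [partialDeriv, fderiv_add hf hh]
  rfl

theorem contMDiff_re {u : N → 𝕜} (hu : ContMDiff (𝓡 n) 𝓘(ℝ, 𝕜) ∞ u) :
    ContMDiff (𝓡 n) 𝓘(ℝ, ℝ) ∞ fun x => re (u x) :=
  (reCLM (K := 𝕜)).contDiff.comp_contMDiff hu

theorem contMDiff_im {u : N → 𝕜} (hu : ContMDiff (𝓡 n) 𝓘(ℝ, 𝕜) ∞ u) :
    ContMDiff (𝓡 n) 𝓘(ℝ, ℝ) ∞ fun x => im (u x) :=
  (imCLM (K := 𝕜)).contDiff.comp_contMDiff hu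

variable [IsManifold (𝓡 n) ∞ N]

theorem gradInner_symm (g : Metric n N) (u v : N → ℝ) (x : N) :
    gradInner g u v x = gradInner g v u x := dualMetric_symm g x _ _

theorem differentiableAt_comp_chart_symm {u : N → 𝕜} (hu : ContMDiff (𝓡 n) 𝓘(ℝ, 𝕜) ∞ u) {p : N}
    {y : EuclideanSpace ℝ (Fin n)} (hy : y ∈ (extChartAt (𝓡 n) p).target) :
    DifferentiableAt ℝ (u ∘ (extChartAt (𝓡 n) p).symm) y :=
  ((contDiffOn_comp_chart_symm hu p).contDiffAt
    ((isOpen_extChartAt_target p).mem_nhds hy)).differentiableAt (by simp)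

theorem differentiableAt_flux (g : Metric n N) {u : N → 𝕜} (hu : ContMDiff (𝓡 n) 𝓘(ℝ, 𝕜) ∞ u)
    {p : N} {y : EuclideanSpace ℝ (Fin n)} (hy : y ∈ (extChartAt (𝓡 n) p).target) (i : Fin n) :
    DifferentiableAt ℝ (flux g p u i) y :=
  ((contDiffOn_flux g p hu i).contDiffAt
    ((isOpen_extChartAt_target p).mem_nhds hy)).differentiableAt (by simp)

/-- The coefficients of the Laplacian are real. Taking `T` to be the real part, the imaginary part
or a scalar multiplication reduces everything to real functions. -/
theorem laplacian_clm_comp (g : Metric n N) (T : 𝕜 →L[ℝ] 𝕜') {u : N → 𝕜}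
    (hu : ContMDiff (𝓡 n) 𝓘(ℝ, 𝕜) ∞ u) (x : N) :
    laplacian g (fun z => T (u z)) x = T (laplacian g u x) := by
  have hx : extChartAt (𝓡 n) x x ∈ (extChartAt (𝓡 n) x).target := mem_extChartAt_target x
  have hflux : ∀ i, ∀ y ∈ (extChartAt (𝓡 n) x).target,
      flux g x (fun z => T (u z)) i y = T (flux g x u i y) := fun i y hy => by
    simp only [flux, map_smul, map_sum]
    congr 1
    refine Finset.sum_congr rfl fun j _ => ?_
    congr 1
    exact partialDeriv_clm_comp T (differentiableAt_comp_chart_symm hu hy) j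
  rw [laplacian_eq, laplacian_eq, chartLaplacian, chartLaplacian, map_smul, map_sum]
  congr 1
  refine Finset.sum_congr rfl fun i _ => ?_
  rw [← partialDeriv_clm_comp T (differentiableAt_flux g hu hx i)]
  have he : flux g x (fun z => T (u z)) i =ᶠ[𝓝 (extChartAt (𝓡 n) x x)]
      fun y => T (flux g x u i y) := by
    filter_upwards [(isOpen_extChartAt_target x).mem_nhds hx] with y hy using hflux i y hy
  rw [partialDeriv, he.fderiv_eq, partialDeriv]

theorem laplacian_add (g : Metric n N) {u v : N → 𝕜}
    (hu : ContMDiff (𝓡 n) 𝓘(ℝ, 𝕜) ∞ u) (hv : ContMDiff (𝓡 n) 𝓘(ℝ, 𝕜) ∞ v) :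
    laplacian g (u + v) = laplacian g u + laplacian g v := by
  ext x
  have hx : extChartAt (𝓡 n) x x ∈ (extChartAt (𝓡 n) x).target := mem_extChartAt_target x
  have hflux : ∀ i, ∀ y ∈ (extChartAt (𝓡 n) x).target,
      flux g x (u + v) i y = (flux g x u i + flux g x v i) y := fun i y hy => by
    simp only [flux, Pi.add_apply]
    rw [← smul_add, ← Finset.sum_add_distrib]
    congr 1
    refine Finset.sum_congr rfl fun j _ => ?_
    rw [← smul_add]
    congr 1
    exact partialDeriv_add (differentiableAt_comp_chart_symm hu hy)
      (differentiableAt_comp_chart_symm hv hy) j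
  rw [Pi.add_apply, laplacian_eq, laplacian_eq, laplacian_eq, chartLaplacian, chartLaplacian,
    chartLaplacian, ← smul_add, ← Finset.sum_add_distrib]
  congr 1
  refine Finset.sum_congr rfl fun i _ => ?_
  rw [← partialDeriv_add (differentiableAt_flux g hu hx i) (differentiableAt_flux g hv hx i)]
  have he : flux g x (u + v) i =ᶠ[𝓝 (extChartAt (𝓡 n) x x)] (flux g x u i + flux g x v i) := by
    filter_upwards [(isOpen_extChartAt_target x).mem_nhds hx] with y hy using hflux i y hy
  rw [partialDeriv, he.fderiv_eq, partialDeriv]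

theorem laplacian_smul (g : Metric n N) (c : 𝕜) {u : N → 𝕜}
    (hu : ContMDiff (𝓡 n) 𝓘(ℝ, 𝕜) ∞ u) : laplacian g (c • u) = c • laplacian g u := by
  ext x
  exact laplacian_clm_comp g (ContinuousLinearMap.mul ℝ 𝕜 c) hu x

theorem re_laplacian (g : Metric n N) {u : N → 𝕜} (hu : ContMDiff (𝓡 n) 𝓘(ℝ, 𝕜) ∞ u) (x : N) :
    re (laplacian g u x) = laplacian g (fun z => re (u z)) x :=
  (laplacian_clm_comp g (reCLM (K := 𝕜)) hu x).symm

theorem im_laplacian (g : Metric n N) {u : N → 𝕜} (hu : ContMDiff (𝓡 n) 𝓘(ℝ, 𝕜) ∞ u) (x : N) :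
    im (laplacian g u x) = laplacian g (fun z => im (u z)) x :=
  (laplacian_clm_comp g (imCLM (K := 𝕜)) hu x).symm

variable [CompactSpace N] [MeasurableSpace N] [BorelSpace N]

theorem memLp_of_continuous (g₀ : Metric n N) {f : N → 𝕜} (hf : Continuous f) :
    MemLp f 2 (vol g₀) :=
  hf.memLp_of_hasCompactSupport (HasCompactSupport.of_compactSpace _)

variable [T2Space N]

theorem continuous_laplacian_rclike (g : Metric n N) {u : N → 𝕜}
    (hu : ContMDiff (𝓡 n) 𝓘(ℝ, 𝕜) ∞ u) : Continuous (laplacian g u) := by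
  have h : laplacian g u = fun x => ((laplacian g (fun z => re (u z)) x : ℝ) : 𝕜) +
      ((laplacian g (fun z => im (u z)) x : ℝ) : 𝕜) * I := by
    ext x
    rw [← re_laplacian g hu, ← im_laplacian g hu, re_add_im]
  rw [h]
  exact (continuous_ofReal.comp (continuous_laplacian g (contMDiff_re hu))).add
    ((continuous_ofReal.comp (continuous_laplacian g (contMDiff_im hu))).mul continuous_const)

variable (𝕜 N n) in
/-- The space of smooth functions. -/
def smoothFunctions : Submodule 𝕜 (N → 𝕜) where
  carrier := {u | ContMDiff (𝓡 n) 𝓘(ℝ, 𝕜) ∞ u}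
  add_mem' hu hv := hu.add hv
  zero_mem' := contMDiff_const
  smul_mem' c _ hu := (ContinuousLinearMap.mul ℝ 𝕜 c).contDiff.comp_contMDiff hu

/-- The inclusion of the smooth functions in `L²`. -/
def smoothToLp (g₀ : Metric n N) : smoothFunctions n N 𝕜 →ₗ[𝕜] Lp 𝕜 2 (vol g₀) where
  toFun u := (memLp_of_continuous g₀ u.2.continuous).toLp u
  map_add' _ _ := rfl
  map_smul' _ _ := rfl

/-- The Laplacian of `g` on smooth functions, with values in `L²`. -/
def laplacianToLp (g₀ g : Metric n N) : smoothFunctions n N 𝕜 →ₗ[𝕜] Lp 𝕜 2 (vol g₀) where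
  toFun u := (memLp_of_continuous g₀ (continuous_laplacian_rclike g u.2)).toLp (laplacian g u)
  map_add' u v := by
    rw [← MemLp.toLp_add]
    exact MemLp.toLp_congr _ _ (Filter.EventuallyEq.of_eq (laplacian_add g u.2 v.2))
  map_smul' c u := by
    rw [RingHom.id_apply, ← MemLp.toLp_const_smul]
    exact MemLp.toLp_congr _ _ (Filter.EventuallyEq.of_eq (laplacian_smul g c u.2))

/-- Green's formula with respect to the measure of another metric, in case the two measures are
proportional. -/
theorem integral_laplacian_mul_of_vol_eq {g₀ g : Metric n N} {c : ℝ} (hc : 0 < c)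
    (hvol : vol g = ENNReal.ofReal c • vol g₀) {u v : N → ℝ}
    (hu : ContMDiff (𝓡 n) 𝓘(ℝ, ℝ) ∞ u) (hv : ContMDiff (𝓡 n) 𝓘(ℝ, ℝ) ∞ v) :
    ∫ x, laplacian g u x * v x ∂(vol g₀) = -∫ x, gradInner g u v x ∂(vol g₀) := by
  have h := integral_laplacian_mul g hu hv
  rw [hvol, integral_smul_measure, integral_smul_measure, ENNReal.toReal_ofReal hc.le,
    ← smul_neg] at h
  exact smul_right_injective ℝ hc.ne' h

theorem re_inner_laplacianToLp {g₀ g : Metric n N} {c : ℝ} (hc : 0 < c)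
    (hvol : vol g = ENNReal.ofReal c • vol g₀) (u v : smoothFunctions n N 𝕜) :
    re (inner 𝕜 (laplacianToLp g₀ g u) (smoothToLp g₀ v)) =
      -∫ x, (gradInner g (fun z => re (u.1 z)) (fun z => re (v.1 z)) x +
        gradInner g (fun z => im (u.1 z)) (fun z => im (v.1 z)) x) ∂(vol g₀) := by
  have hur := contMDiff_re u.2
  have hui := contMDiff_im u.2
  have hvr := contMDiff_re v.2
  have hvi := contMDiff_im v.2
  have hint : ∀ {f : N → ℝ}, Continuous f → Integrable f (vol g₀) := fun hf =>
    hf.integrable_of_hasCompactSupport (HasCompactSupport.of_compactSpace _)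
  have hr : Integrable (fun x => laplacian g (fun z => re (u.1 z)) x * re (v.1 x)) (vol g₀) :=
    hint ((continuous_laplacian g hur).mul hvr.continuous)
  have hi : Integrable (fun x => laplacian g (fun z => im (u.1 z)) x * im (v.1 x)) (vol g₀) :=
    hint ((continuous_laplacian g hui).mul hvi.continuous)
  rw [integral_add (hint (continuous_gradInner g hur hvr))
    (hint (continuous_gradInner g hui hvi)), neg_add,
    ← integral_laplacian_mul_of_vol_eq hc hvol hur hvr,
    ← integral_laplacian_mul_of_vol_eq hc hvol hui hvi,
    ← integral_add hr hi, L2.inner_def,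
    ← integral_re (L2.integrable_inner _ _)]
  refine integral_congr_ae ?_
  filter_upwards [(memLp_of_continuous g₀ (continuous_laplacian_rclike g u.2)).coeFn_toLp,
    (memLp_of_continuous g₀ v.2.continuous).coeFn_toLp] with x h1 h2
  have h1' : (laplacianToLp g₀ g u : N → 𝕜) x = laplacian g u.1 x := h1
  have h2' : (smoothToLp g₀ v : N → 𝕜) x = v.1 x := h2
  rw [h1', h2', RCLike.inner_apply, mul_re, conj_re, conj_im, re_laplacian g u.2,
    im_laplacian g u.2]
  ring

theorem symmOn_laplacianToLp {g₀ g : Metric n N} {c : ℝ} (hc : 0 < c)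
    (hvol : vol g = ENNReal.ofReal c • vol g₀) :
    SymmOn (smoothToLp g₀) (laplacianToLp (𝕜 := 𝕜) g₀ g) := by
  have hre : ∀ u v : smoothFunctions n N 𝕜,
      re (inner 𝕜 (laplacianToLp g₀ g u) (smoothToLp g₀ v)) =
        re (inner 𝕜 (smoothToLp g₀ u) (laplacianToLp g₀ g v)) := fun u v => by
    rw [← inner_conj_symm (smoothToLp g₀ u), conj_re, re_inner_laplacianToLp hc hvol,
      re_inner_laplacianToLp hc hvol]
    simp only [gradInner_symm g (fun z => re (u.1 z)), gradInner_symm g (fun z => im (u.1 z))]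
  intro u v
  refine RCLike.ext (hre u v) ?_
  -- Replacing `v` by `I • v` turns real parts into negated imaginary parts.
  have h := hre u ((I : 𝕜) • v)
  rw [map_smul, map_smul, inner_smul_right, inner_smul_right, I_mul_re, I_mul_re] at h
  exact neg_injective h

theorem energy_laplacianToLp {g₀ g : Metric n N} {c : ℝ} (hc : 0 < c)
    (hvol : vol g = ENNReal.ofReal c • vol g₀) (u : smoothFunctions n N 𝕜) :
    energy (smoothToLp g₀) (laplacianToLp g₀ g) u =
      ∫ x, (gradInner g (fun z => re (u.1 z)) (fun z => re (u.1 z)) x +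
        gradInner g (fun z => im (u.1 z)) (fun z => im (u.1 z)) x) ∂(vol g₀) := by
  rw [energy, re_inner_laplacianToLp hc hvol, neg_neg]

theorem energy_laplacianToLp_nonneg {g₀ g : Metric n N} {c : ℝ} (hc : 0 < c)
    (hvol : vol g = ENNReal.ofReal c • vol g₀) (u : smoothFunctions n N 𝕜) :
    0 ≤ energy (smoothToLp g₀) (laplacianToLp g₀ g) u := by
  rw [energy_laplacianToLp hc hvol]
  have h0 : ∀ (w : N → ℝ) x, 0 ≤ gradInner g w w x := fun w x => by
    by_cases h : differential (n := n) w x = 0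
    · rw [gradInner, dualMetric_eq_apply, h, LinearMap.zero_apply]
    · exact (dualMetric_pos g x h).le
  exact integral_nonneg fun x => add_nonneg (h0 _ x) (h0 _ x)

/-- The forms of two Laplacians compare as the dual metrics do. -/
theorem energy_laplacianToLp_le {g₀ g g' : Metric n N} {c c' r r' : ℝ} (hc : 0 < c) (hc' : 0 < c')
    (hvol : vol g = ENNReal.ofReal c • vol g₀) (hvol' : vol g' = ENNReal.ofReal c' • vol g₀)
    (hr : ∀ (x : N) (α : Module.Dual ℝ (TangentSpace (𝓡 n) x)),
      r * dualMetric g x α α ≤ r' * dualMetric g' x α α) (u : smoothFunctions n N 𝕜) :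
    r * energy (smoothToLp g₀) (laplacianToLp g₀ g) u ≤
      r' * energy (smoothToLp g₀) (laplacianToLp g₀ g') u := by
  have hint : ∀ g : Metric n N, Integrable (fun x =>
      gradInner g (fun z => re (u.1 z)) (fun z => re (u.1 z)) x +
        gradInner g (fun z => im (u.1 z)) (fun z => im (u.1 z)) x) (vol g₀) := fun g =>
    ((continuous_gradInner g (contMDiff_re u.2) (contMDiff_re u.2)).add
      (continuous_gradInner g (contMDiff_im u.2)
        (contMDiff_im u.2))).integrable_of_hasCompactSupport (HasCompactSupport.of_compactSpace _)
  rw [energy_laplacianToLp hc hvol, energy_laplacianToLp hc' hvol', ← integral_const_mul,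
    ← integral_const_mul]
  refine integral_mono ((hint g).const_mul _) ((hint g').const_mul _) fun x => ?_
  simp only [mul_add]
  exact add_le_add (hr x _) (hr x _)

/-- Proportional measures have `L²` seminorms that differ by a factor which is neither zero nor
infinite, so convergence for `vol g` can be tested in the fixed space for `vol g₀`. -/
theorem isL2Laplacian_iff {g₀ g : Metric n N} {c : ℝ} (hc : 0 < c)
    (hvol : vol g = ENNReal.ofReal c • vol g₀) {f h : N → 𝕜} (hf : MemLp f 2 (vol g₀))
    (hh : MemLp h 2 (vol g₀)) :
    IsL2Laplacian g f h ↔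
      ClosureGraph (smoothToLp g₀) (laplacianToLp g₀ g) (hf.toLp f) (hh.toLp h) := by
  have h0 : ENNReal.ofReal c ≠ 0 := (ENNReal.ofReal_pos.mpr hc).ne'
  have hlim : ∀ F : ℕ → N → 𝕜, Filter.Tendsto (fun k => eLpNorm (F k) 2 (vol g)) Filter.atTop
      (𝓝 0) ↔ Filter.Tendsto (fun k => eLpNorm (F k) 2 (vol g₀)) Filter.atTop (𝓝 0) := fun F => by
    set a := ENNReal.ofReal c ^ (1 / (2 : ℝ≥0∞)).toReal with ha
    have ha0 : a ≠ 0 := (ENNReal.rpow_pos (ENNReal.ofReal_pos.mpr hc) ENNReal.ofReal_ne_top).ne'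
    have hat : a ≠ ⊤ := ENNReal.rpow_ne_top_of_nonneg ENNReal.toReal_nonneg ENNReal.ofReal_ne_top
    simp only [hvol, eLpNorm_smul_measure_of_ne_zero h0, smul_eq_mul, ← ha]
    constructor
    · intro h
      have := ENNReal.Tendsto.const_mul (a := a⁻¹) h (Or.inr (ENNReal.inv_ne_top.mpr ha0))
      simpa only [← mul_assoc, ENNReal.inv_mul_cancel ha0 hat, one_mul, mul_zero] using this
    · intro h
      simpa only [mul_zero] using ENNReal.Tendsto.const_mul (a := a) h (Or.inr hat)
  constructor
  · rintro ⟨-, -, u, hu, h1, h2⟩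
    refine ⟨fun k => ⟨u k, hu k⟩, ?_, ?_⟩
    · exact (Lp.tendsto_Lp_iff_tendsto_eLpNorm'' u
        (fun k => memLp_of_continuous g₀ (hu k).continuous) f hf).mpr ((hlim _).mp h1)
    · exact (Lp.tendsto_Lp_iff_tendsto_eLpNorm'' (fun k => laplacian g (u k))
        (fun k => memLp_of_continuous g₀ (continuous_laplacian_rclike g (hu k))) h hh).mpr
          ((hlim _).mp h2)
  · rintro ⟨u, h1, h2⟩
    refine ⟨hvol ▸ hf.smul_measure ENNReal.ofReal_ne_top,
      hvol ▸ hh.smul_measure ENNReal.ofReal_ne_top, fun k => (u k).1, fun k => (u k).2, ?_, ?_⟩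
    · exact (hlim _).mpr ((Lp.tendsto_Lp_iff_tendsto_eLpNorm'' (fun k => (u k).1)
        (fun k => memLp_of_continuous g₀ (u k).2.continuous) f hf).mp h1)
    · exact (hlim _).mpr ((Lp.tendsto_Lp_iff_tendsto_eLpNorm'' (fun k => laplacian g (u k).1)
        (fun k => memLp_of_continuous g₀ (continuous_laplacian_rclike g (u k).2)) h hh).mp h2)

theorem isL2Laplacian_coe_iff {g₀ g : Metric n N} {c : ℝ} (hc : 0 < c)
    (hvol : vol g = ENNReal.ofReal c • vol g₀) (f h : Lp 𝕜 2 (vol g₀)) :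
    IsL2Laplacian g (f : N → 𝕜) (h : N → 𝕜) ↔
      ClosureGraph (smoothToLp g₀) (laplacianToLp g₀ g) f h := by
  rw [isL2Laplacian_iff hc hvol (Lp.memLp f) (Lp.memLp h), Lp.toLp_coeFn, Lp.toLp_coeFn]

theorem laplaceEigenvalues_eq {g₀ g : Metric n N} {c : ℝ} (hc : 0 < c)
    (hvol : vol g = ENNReal.ofReal c • vol g₀) (V : Submodule 𝕜 (Lp 𝕜 2 (vol g₀))) :
    laplaceEigenvalues g V = negEigenvalues (smoothToLp g₀) (laplacianToLp g₀ g) V := by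
  ext l
  refine exists_congr fun f => and_congr_right fun _ => and_congr_right fun _ => ?_
  rw [isL2Laplacian_iff hc hvol (Lp.memLp f) ((Lp.memLp f).const_smul (-l)),
    MemLp.toLp_const_smul _ (Lp.memLp f), Lp.toLp_coeFn]

end ScalarValued

/-! ### Consequences of invariance under a transitive action -/

section Homogeneous

open MeasureTheory

variable {n : ℕ} {N : Type*} [TopologicalSpace N] [ChartedSpace (EuclideanSpace ℝ (Fin n)) N]
  [IsManifold (𝓡 n) ∞ N]

/-- The eigenvalues of one dual metric with respect to another at a point. -/
def dualEigenvaluesAt (g₁ g₂ : Metric n N) (x : N) : Set ℝ :=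
  {r | ∃ α : Module.Dual ℝ (TangentSpace (𝓡 n) x), α ≠ 0 ∧
    ∀ β, dualMetric g₁ x α β = r * dualMetric g₂ x α β}

theorem dualEigenvaluesAt_pos {g₁ g₂ : Metric n N} {x : N} {r : ℝ}
    (hr : r ∈ dualEigenvaluesAt g₁ g₂ x) : 0 < r := by
  obtain ⟨α, hα, h⟩ := hr
  have h1 := dualMetric_pos g₁ x hα
  rw [h α] at h1
  exact pos_of_mul_pos_left h1 (dualMetric_pos g₂ x hα).le

/-- The inner product on a cotangent space that is given by the dual metric. -/
@[reducible]
def dualCore (g : Metric n N) (x : N) :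
    InnerProductSpace.Core ℝ (Module.Dual ℝ (TangentSpace (𝓡 n) x)) where
  inner α β := dualMetric g x α β
  conj_inner_symm α β := dualMetric_symm g x β α
  re_inner_nonneg α := by
    by_cases h : α = 0
    · simp [h, dualMetric_eq_apply]
    · exact (dualMetric_pos g x h).le
  add_left α β γ := by simp only [dualMetric_eq_apply, LinearMap.add_apply]
  smul_left α β r := by simp [dualMetric_eq_apply]
  definite α h := by
    by_contra hα
    exact (dualMetric_pos g x hα).ne' h

theorem exists_extremal_dualEigenvaluesAt (hn : 0 < n) (g₁ g₂ : Metric n N) (x : N) :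
    ∃ a b : ℝ, IsLeast (dualEigenvaluesAt g₁ g₂ x) a ∧
      IsGreatest (dualEigenvaluesAt g₁ g₂ x) b ∧
      ∀ α, a * dualMetric g₂ x α α ≤ dualMetric g₁ x α α ∧
        dualMetric g₁ x α α ≤ b * dualMetric g₂ x α α := by
  let E := Module.Dual ℝ (TangentSpace (𝓡 n) x)
  let _ : NormedAddCommGroup E := (dualCore g₂ x).toNormedAddCommGroup
  let _ : InnerProductSpace ℝ E := InnerProductSpace.ofCore (dualCore g₂ x).toCore
  have hinner : ∀ α β : E, inner ℝ α β = dualMetric g₂ x α β := fun _ _ => rfl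
  have hfin : Module.finrank ℝ E = n := by
    rw [Subspace.dual_finrank_eq]
    exact finrank_euclideanSpace_fin
  have : Nontrivial E := Module.nontrivial_of_finrank_pos (R := ℝ) (by rw [hfin]; exact hn)
  -- Raise with `g₁`, lower with `g₂`: this endomorphism represents `g₁⁻¹` with respect to the inner
  -- product `g₂⁻¹`, so it is symmetric and its eigenvalues are the relative ones.
  let T : E →ₗ[ℝ] E := (sharp g₂ x).symm.toLinearMap ∘ₗ (sharp g₁ x).toLinearMap
  have hT : ∀ α β : E, dualMetric g₂ x (T α) β = dualMetric g₁ x α β := fun α β => by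
    rw [dualMetric_symm, dualMetric_eq_apply, dualMetric_symm g₁, dualMetric_eq_apply]
    simp only [T, LinearMap.comp_apply, LinearEquiv.coe_coe, LinearEquiv.apply_symm_apply]
  have hsymm : T.IsSymmetric := fun α β => by
    rw [hinner, hinner, hT, dualMetric_symm g₂ x α, hT, dualMetric_symm]
  obtain ⟨a, b, ha, hb, hab⟩ := exists_extremal_eigenvalues (𝕜 := ℝ) hsymm
  have hset : dualEigenvaluesAt g₁ g₂ x =
      {μ : ℝ | ∃ α : E, α ≠ 0 ∧ T α = ((μ : ℝ) : ℝ) • α} := by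
    ext r
    refine exists_congr fun α => and_congr_right fun _ => ?_
    constructor
    · intro h
      refine ext_inner_right ℝ fun β => ?_
      rw [inner_smul_left, hinner, hinner, hT, h]
      rfl
    · intro h β
      rw [← hT, h, dualMetric_eq_apply, dualMetric_eq_apply, LinearMap.smul_apply, smul_eq_mul]
  rw [hset]
  refine ⟨a, b, ha, hb, fun α => ?_⟩
  have := hab α
  rwa [hinner, hT, ← real_inner_self_eq_norm_sq, hinner] at this

variable {g g₁ g₂ : Metric n N}

theorem dualMetric_comp {x y : N} (A : TangentSpace (𝓡 n) x ≃ₗ[ℝ] TangentSpace (𝓡 n) y)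
    (hA : ∀ v w, g.inner y (A v) (A w) = g.inner x v w)
    (α β : Module.Dual ℝ (TangentSpace (𝓡 n) y)) :
    dualMetric g x (α ∘ₗ A.toLinearMap) (β ∘ₗ A.toLinearMap) = dualMetric g y α β := by
  have h : sharp g x (β ∘ₗ A.toLinearMap) = A.symm (sharp g y β) := by
    apply flat_injective g x
    ext v
    change g.inner x _ v = g.inner x _ v
    rw [inner_sharp, ← hA, A.apply_symm_apply, inner_sharp]
    rfl
  rw [dualMetric_eq_apply, dualMetric_eq_apply, h, LinearMap.comp_apply, LinearEquiv.coe_coe,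
    A.apply_symm_apply]

theorem dualEigenvaluesAt_subset {x y : N}
    (A : TangentSpace (𝓡 n) x ≃ₗ[ℝ] TangentSpace (𝓡 n) y)
    (h₁ : ∀ v w, g₁.inner y (A v) (A w) = g₁.inner x v w)
    (h₂ : ∀ v w, g₂.inner y (A v) (A w) = g₂.inner x v w) :
    dualEigenvaluesAt g₁ g₂ y ⊆ dualEigenvaluesAt g₁ g₂ x := by
  rintro r ⟨α, hα, h⟩
  refine ⟨α ∘ₗ A.toLinearMap, fun h0 => hα ?_, fun β => ?_⟩
  · ext v
    rw [← A.apply_symm_apply v]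
    exact LinearMap.congr_fun h0 _
  · have hβ : β = (β ∘ₗ A.symm.toLinearMap) ∘ₗ A.toLinearMap := by
      ext v
      simp
    rw [hβ, dualMetric_comp A h₁, dualMetric_comp A h₂, h]

theorem gramOf_linearCombination (x : N) (b : Fin n → TangentSpace (𝓡 n) x)
    (P : Matrix (Fin n) (Fin n) ℝ) :
    gramOf g x (fun i => ∑ k, P k i • b k) = P.transpose * gramOf g x b * P := by
  ext i j
  refine (inner_sum_sum g x b (fun k => P k i) (fun k => P k j)).trans ?_
  rw [Matrix.mul_assoc, Matrix.mul_apply, dotProduct]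
  rfl

/-- A change of basis multiplies both determinants by the same square, so their ratio is independent
of the basis. -/
theorem det_gramOf_mul (x : N) (b b' : Module.Basis (Fin n) ℝ (TangentSpace (𝓡 n) x)) :
    (gramOf g₁ x b').det * (gramOf g₂ x b).det = (gramOf g₁ x b).det * (gramOf g₂ x b').det := by
  have h : (b' : Fin n → TangentSpace (𝓡 n) x) = fun i => ∑ k, b.toMatrix b' k i • b k := by
    ext1 i
    exact (b.sum_toMatrix_smul_self b' i).symm
  rw [h, gramOf_linearCombination, gramOf_linearCombination]
  simp only [Matrix.det_mul, Matrix.det_transpose]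
  ring

theorem det_gramOf_mul_of_isometry {x y : N}
    (A : TangentSpace (𝓡 n) x ≃ₗ[ℝ] TangentSpace (𝓡 n) y)
    (h₁ : ∀ v w, g₁.inner y (A v) (A w) = g₁.inner x v w)
    (h₂ : ∀ v w, g₂.inner y (A v) (A w) = g₂.inner x v w)
    (b : Module.Basis (Fin n) ℝ (TangentSpace (𝓡 n) x))
    (b' : Module.Basis (Fin n) ℝ (TangentSpace (𝓡 n) y)) :
    (gramOf g₁ y b').det * (gramOf g₂ x b).det = (gramOf g₁ x b).det * (gramOf g₂ y b').det := by
  have e₁ : gramOf g₁ x b = gramOf g₁ y (b.map A) := by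
    ext i j
    simp [gramOf, h₁]
  have e₂ : gramOf g₂ x b = gramOf g₂ y (b.map A) := by
    ext i j
    simp [gramOf, h₂]
  rw [e₁, e₂, det_gramOf_mul]

variable {G : Type*} [Group G] [MulAction G N] [MulAction.IsPretransitive G N]

/-- A single linear map serves both metrics: the differential of a group element moving `x` to `y`.
It is injective because it preserves the positive definite `g₁`, hence bijective by equality of
dimensions. -/
theorem exists_isometry (h₁ : IsInvariantMetric G g₁) (h₂ : IsInvariantMetric G g₂) (x y : N) :
    ∃ A : TangentSpace (𝓡 n) x ≃ₗ[ℝ] TangentSpace (𝓡 n) y,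
      (∀ v w, g₁.inner y (A v) (A w) = g₁.inner x v w) ∧
      ∀ v w, g₂.inner y (A v) (A w) = g₂.inner x v w := by
  obtain ⟨k, rfl⟩ := MulAction.exists_smul_eq G x y
  let D : TangentSpace (𝓡 n) x →ₗ[ℝ] TangentSpace (𝓡 n) (k • x) :=
    (mfderiv (𝓡 n) (𝓡 n) (fun z : N => k • z) x).toLinearMap
  have hD : Function.Injective D := by
    rw [injective_iff_map_eq_zero]
    intro v hv
    by_contra h
    have h0 := h₁ k x v v
    have hv' : mfderiv (𝓡 n) (𝓡 n) (fun z : N => k • z) x v = 0 := hv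
    rw [hv', map_zero] at h0
    exact (g₁.pos x v h).ne h0
  exact ⟨LinearMap.linearEquivOfInjective D hD rfl, h₁ k x, h₂ k x⟩

theorem exists_vol_eq_smul [MeasurableSpace N] [BorelSpace N] (h₁ : IsInvariantMetric G g₁)
    (h₂ : IsInvariantMetric G g₂) (p : N) :
    ∃ c : ℝ, 0 < c ∧ vol g₁ = ENNReal.ofReal c • vol g₂ := by
  set z := extChartAt (𝓡 n) p p
  have hz : z ∈ (extChartAt (𝓡 n) p).target := mem_extChartAt_target p
  -- The constant is the density ratio at the base point `p`; every other point and chart gives the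
  -- same ratio by the isometry invariance of the determinant ratio.
  refine ⟨density g₁ p z / density g₂ p z, div_pos (density_pos g₁ hz) (density_pos g₂ hz),
    vol_eq_smul (div_pos (density_pos g₁ hz) (density_pos g₂ hz)) fun q y hy => ?_⟩
  obtain ⟨A, hA₁, hA₂⟩ := exists_isometry h₁ h₂ ((extChartAt (𝓡 n) p).symm z)
    ((extChartAt (𝓡 n) q).symm y)
  have h := det_gramOf_mul_of_isometry A hA₁ hA₂ (coordBasis hz) (coordBasis hy)
  rw [← gram_eq g₁ hy, ← gram_eq g₂ hy, ← gram_eq g₁ hz, ← gram_eq g₂ hz] at h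
  have h' := congrArg Real.sqrt h
  rw [Real.sqrt_mul (gram_posDef g₁ hy).det_pos.le, Real.sqrt_mul (gram_posDef g₁ hz).det_pos.le]
    at h'
  rw [div_mul_eq_mul_div, eq_div_iff (density_pos g₂ hz).ne']
  exact h'

theorem dualEigenvalues_eq_at (h₁ : IsInvariantMetric G g₁) (h₂ : IsInvariantMetric G g₂)
    (x : N) : dualEigenvalues g₁ g₂ = dualEigenvaluesAt g₁ g₂ x := by
  refine Set.Subset.antisymm ?_ fun r hr => ⟨x, hr⟩
  rintro r ⟨y, hr⟩
  obtain ⟨A, hA₁, hA₂⟩ := exists_isometry h₁ h₂ x y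
  exact dualEigenvaluesAt_subset A hA₁ hA₂ hr

theorem exists_extremal_dualEigenvalues [Nonempty N] (hn : 0 < n) (h₁ : IsInvariantMetric G g₁)
    (h₂ : IsInvariantMetric G g₂) :
    ∃ a b : ℝ, 0 < a ∧ IsLeast (dualEigenvalues g₁ g₂) a ∧
      IsGreatest (dualEigenvalues g₁ g₂) b ∧
      ∀ x α, a * dualMetric g₂ x α α ≤ dualMetric g₁ x α α ∧
        dualMetric g₁ x α α ≤ b * dualMetric g₂ x α α := by
  obtain ⟨x₀⟩ := ‹Nonempty N›
  obtain ⟨a, b, ha, hb, -⟩ := exists_extremal_dualEigenvaluesAt hn g₁ g₂ x₀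
  have hpos := dualEigenvaluesAt_pos ha.1
  rw [← dualEigenvalues_eq_at h₁ h₂] at ha hb
  refine ⟨a, b, hpos, ha, hb, fun x => ?_⟩
  -- The extreme eigenvalues at `x` are those at `x₀`, so the pointwise bounds at `x` hold with the
  -- global constants.
  obtain ⟨a', b', ha', hb', hab⟩ := exists_extremal_dualEigenvaluesAt hn g₁ g₂ x
  rw [← dualEigenvalues_eq_at h₁ h₂] at ha' hb'
  rw [ha.unique ha', hb.unique hb']
  exact hab

end Homogeneous

/-! ### Separation of the quotient and the main theorem -/

theorem t2Space_quotient {G : Type*} [Group G] [TopologicalSpace G] [IsTopologicalGroup G]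
    {H : Subgroup G} (hH : IsClosed (H : Set G)) : T2Space (G ⧸ H) := by
  rw [t2Space_iff_of_isOpenQuotientMap QuotientGroup.isOpenQuotientMap_mk]
  have : {q : G × G | (QuotientGroup.mk q.1 : G ⧸ H) = QuotientGroup.mk q.2} =
      (fun q : G × G => q.1⁻¹ * q.2) ⁻¹' H := by
    ext q
    exact QuotientGroup.eq
  rw [this]
  exact hH.preimage (by fun_prop)

end HomogeneousLaplace

end

theorem mainTheorem4 {𝕜 : Type*} [RCLike 𝕜] {d n : ℕ} (hn : 0 < n)
    {G : Type*} [Group G] [TopologicalSpace G] [ChartedSpace (EuclideanSpace ℝ (Fin d)) G]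
    [LieGroup (𝓡 d) ∞ G] [CompactSpace G]
    (H : Subgroup G) (hH : IsClosed (H : Set G))
    [ChartedSpace (EuclideanSpace ℝ (Fin n)) (G ⧸ H)] [IsManifold (𝓡 n) ∞ (G ⧸ H)]
    [ContMDiffSMul (𝓡 d) (𝓡 n) ∞ G (G ⧸ H)]
    [MeasurableSpace (G ⧸ H)] [BorelSpace (G ⧸ H)]
    (g₁ g₂ : HomogeneousLaplace.Metric n (G ⧸ H))
    (hg₁ : HomogeneousLaplace.IsInvariantMetric G g₁)
    (hg₂ : HomogeneousLaplace.IsInvariantMetric G g₂)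
    (V : Submodule 𝕜 (MeasureTheory.Lp 𝕜 2 (HomogeneousLaplace.vol g₂)))
    [FiniteDimensional 𝕜 V] (hV : V ≠ ⊥)
    (hV₁ : HomogeneousLaplace.LaplacianInvariant g₁ V)
    (hV₂ : HomogeneousLaplace.LaplacianInvariant g₂ V) :
    ∃ rmin rmax μmin μmax : ℝ,
      IsLeast (HomogeneousLaplace.dualEigenvalues g₁ g₂) rmin ∧
      IsGreatest (HomogeneousLaplace.dualEigenvalues g₁ g₂) rmax ∧
      IsLeast {μ : ℝ | (μ : 𝕜) ∈ HomogeneousLaplace.laplaceEigenvalues g₂ V} μmin ∧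
      IsGreatest {μ : ℝ | (μ : 𝕜) ∈ HomogeneousLaplace.laplaceEigenvalues g₂ V} μmax ∧
      ∀ l ∈ HomogeneousLaplace.laplaceEigenvalues g₁ V,
        ∃ t : ℝ, l = (t : 𝕜) ∧ rmin * μmin ≤ t ∧ t ≤ rmax * μmax := by
  open HomogeneousLaplace in
  have : IsTopologicalGroup G := topologicalGroup_of_lieGroup (𝓡 d) ∞
  have : T2Space (G ⧸ H) := t2Space_quotient hH
  obtain ⟨c, hc, hvol₁⟩ := exists_vol_eq_smul hg₁ hg₂ (QuotientGroup.mk 1)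
  -- The Hilbert space is `L²` of `vol g₂`, so `g₂` enters the general lemmas with proportionality
  -- constant `1`.
  have hvol₂ : vol g₂ = ENNReal.ofReal 1 • vol g₂ := by simp
  obtain ⟨a, b, ha0, ha, hb, hab⟩ := exists_extremal_dualEigenvalues hn hg₁ hg₂
  have hab0 : a ≤ b := ha.2 hb.1
  obtain ⟨μ₀, μ₁, hμ₀, hμ₁, hμ⟩ := eigenvalue_bounds (ι := smoothToLp g₂)
    (L₁ := laplacianToLp (𝕜 := 𝕜) g₂ g₁) (L₂ := laplacianToLp g₂ g₂)
    (symmOn_laplacianToLp hc hvol₁) (symmOn_laplacianToLp one_pos hvol₂) ha0.le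
    (ha0.le.trans hab0) (energy_laplacianToLp_nonneg one_pos hvol₂)
    (fun u => by
      simpa only [one_mul] using energy_laplacianToLp_le (r' := 1) one_pos hc hvol₂ hvol₁
        (fun x α => by simpa only [one_mul] using (hab x α).1) u)
    (fun u => by
      simpa only [one_mul] using energy_laplacianToLp_le (r := 1) hc one_pos hvol₁ hvol₂
        (fun x α => by simpa only [one_mul] using (hab x α).2) u)
    hV (fun f hf => by
      obtain ⟨h, hh, hfh⟩ := hV₂ f hf
      exact ⟨h, hh, (isL2Laplacian_coe_iff one_pos hvol₂ f h).mp hfh⟩)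
  rw [← laplaceEigenvalues_eq one_pos hvol₂] at hμ₀ hμ₁
  rw [← laplaceEigenvalues_eq hc hvol₁] at hμ
  exact ⟨a, b, μ₀, μ₁, ha, hb, hμ₀, hμ₁, hμ⟩
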